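/- Let $m,d,b\ge 1$ and $V=\{1,\dots,m\}$. For each $i\in V$ let $f_i:\mathbb{R}^d\to\mathbb{R}$ be a function, $I_i$ a finite index set and $\mathcal X_i^j\subseteq\mathbb{R}^d$, $j\in I_i$, sets; put $\mathcal X_i=\bigcap_{j\in I_i}\mathcal X_i^j$, $\mathcal X=\bigcap_{i=1}^m\mathcal X_i$, and let $\mathcal X^*$ be the set of minimizers of $f=\sum_{i=1}^m f_i$ over $\mathcal X$. Write $\Pi_{\mathcal Y}$ for the Euclidean projection onto $\mathcal Y$. Consider the mini-batch random projection algorithm: from (possibly random) initial points $x_i(0)$, for $k\ge 0$ and $i\in V$, $$v_i(k)=\sum_{j=1}^m [W(k)]_{ij}\,x_j(k),\qquad \psi_i^0(k)=v_i(k)-\alpha_k\nabla f_i(v_i(k)),$$ $$\psi_i^r(k)=\Pi_{\mathcal X_i^{\Omega_i^r(k)}}[\psi_i^{r-1}(k)]\ \ (r=1,\dots,b),\qquad x_i(k+1)=\psi_i^b(k),$$ with deterministic stepsizes $\alpha_k>0$, deterministic $m\times m$ matrices $W(k)$, and random indices $\Omega_i^r(k)\in I_i$. Assume the following. 1. All sets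 $\mathcal X_i^j$ are closed and convex; each $f_i$ is convex and differentiable; there is a constant $L$ with $\|\nabla f_i(x)-\nabla f_i(y)\|\le L\|x-y\|$ for all $x,y\in\mathbb{R}^d$ and $i\in V$; and there is a constant $G_f$ with $\|\nabla f_i(x)\|\le G_f$ for all $x\in\mathcal X$ and $i\in V$. 2. For all $i\in V$, $j\in I_i$, $k\ge0$, $1\le r\le b$ one has $\Pr\{\Omega_i^r(k)=j\}=\pi_i^j>0$, where $\pi_i^j$ does not depend on $k$ and $r$. For every $i$ and $k$ the variables $\Omega_i^1(k),\dots,\Omega_i^b(k)$ are mutually independent, and this collection is independent of the past $\tilde{\mathcal F}_k$, the $\sigma$-algebra generated by $x_l(0)$, $l\in V$, and $\Omega_l^s(t)$, $l\in V$, $1\le s\le b$, $0\le t<k$. (Different agents' samples at the same time need not be independent.) 3. For every $i\in V$ there is a constant $c>0$ such that $\operatorname{dist}^2(x,\mathcal X)\le c\,\mathsf E[\operatorname{dist}^2(x,\mathcal X_i^{\Omega_i^r(k)})]$ for all $x\in\mathbb{R}^d$ (the right-hand side does not depend on $k$ and $r$). 4. $(V,E(k))$, $k\ge0$, are directed graphs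 with $(i,i)\in E(k)$ for all $i\in V$ and $k\ge 0$, and there is an integer $Q$ such that $\left(V,\bigcup_{\ell=0}^{Q-1}E(k+\ell)\right)$ is strongly connected for all $k\ge0$. 5. For all $k\ge 0$: $[W(k)]_{ij}\ge 0$ for all $i,j$, and $[W(k)]_{ij}=0$ when $(i,j)\notin E(k)$; all row sums and all column sums of $W(k)$ equal $1$; and there is a scalar $\eta\in(0,1)$, the same for all $k$, such that $[W(k)]_{ij}\ge\eta$ when $(i,j)\in E(k)$. Assume moreover that $\sum_{k=0}^\infty\alpha_k=\infty$, $\sum_{k=0}^\infty\alpha_k^2<\infty$, and that $\mathcal X^*$ is nonempty. Then there is a random vector $x^\star$ with values in $\mathcal X^*$ such that, almost surely, $\lim_{k\to\infty}x_i(k)=x^\star$ for all $i\in V$. -/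

import Mathlib

noncomputable section

namespace DRP

/-- The Euclidean projection of `x` on `K`: a point of `K` minimizing `‖v - x‖ ^ 2` over `v ∈ K`.
Such a point exists and is unique when `K` is nonempty, closed and convex; for other sets `K` the
value is of no significance. -/
def proj {d : ℕ} (K : Set (EuclideanSpace ℝ (Fin d))) (x : EuclideanSpace ℝ (Fin d)) :
    EuclideanSpace ℝ (Fin d) :=
  Classical.epsilon fun y => y ∈ K ∧ IsMinOn (fun v => ‖v - x‖ ^ 2) K y

/-- The feasible set: the intersection over all agents `i` of the local constraint sets
`⋂ j, X i j`. -/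
def feasibleSet {d m : ℕ} {n : Fin m → ℕ}
    (X : (i : Fin m) → Fin (n i) → Set (EuclideanSpace ℝ (Fin d))) :
    Set (EuclideanSpace ℝ (Fin d)) :=
  ⋂ i, ⋂ j, X i j

/-- The set of minimizers of `∑ i, f i` over the feasible set. -/
def optimalSet {d m : ℕ} {n : Fin m → ℕ} (f : Fin m → EuclideanSpace ℝ (Fin d) → ℝ)
    (X : (i : Fin m) → Fin (n i) → Set (EuclideanSpace ℝ (Fin d))) :
    Set (EuclideanSpace ℝ (Fin d)) :=
  {x | x ∈ feasibleSet X ∧ IsMinOn (fun y => ∑ i, f i y) (feasibleSet X) x}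

/-- Every vertex can be reached from every vertex along the edges of `G`. -/
def StronglyConnected {V : Type*} (G : Digraph V) : Prop :=
  ∀ i j : V, Relation.ReflTransGen G.Adj i j

/-- Successive projections of `y`, first on `C 0`, then on `C 1`, and so on, last on
`C (b - 1)`. -/
def batchProj {d : ℕ} : (b : ℕ) → (Fin b → Set (EuclideanSpace ℝ (Fin d))) →
    EuclideanSpace ℝ (Fin d) → EuclideanSpace ℝ (Fin d)
  | 0, _, y => y
  | b + 1, C, y => proj (C (Fin.last b)) (batchProj b (fun r => C r.castSucc) y)

/-- The mixing step `v_i = ∑ j, [W]_{ij} x_j`. -/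
def mix {d m : ℕ} (W : Matrix (Fin m) (Fin m) ℝ) (x : Fin m → EuclideanSpace ℝ (Fin d))
    (i : Fin m) : EuclideanSpace ℝ (Fin d) :=
  ∑ j, W i j • x j

/-- The iterates `x_i(k)` of the mini-batch method, as a function of the initial points `x₀` and of
the sampled indices: `s i k r` is the index drawn by agent `i` at time `k` for its projection
number `r`. -/
def iterates {d m b : ℕ} {n : Fin m → ℕ} (f : Fin m → EuclideanSpace ℝ (Fin d) → ℝ)
    (X : (i : Fin m) → Fin (n i) → Set (EuclideanSpace ℝ (Fin d)))
    (W : ℕ → Matrix (Fin m) (Fin m) ℝ) (α : ℕ → ℝ)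
    (x₀ : Fin m → EuclideanSpace ℝ (Fin d)) (s : (i : Fin m) → ℕ → Fin b → Fin (n i)) :
    ℕ → Fin m → EuclideanSpace ℝ (Fin d)
  | 0 => x₀
  | k + 1 => fun i =>
      batchProj b (fun r => X i (s i k r))
        (mix (W k) (iterates f X W α x₀ s k) i
          - α k • gradient (f i) (mix (W k) (iterates f X W α x₀ s k) i))

/-- The σ-algebra of the past at time `k`, generated by all initial points and by all indices that
were sampled, by any agent, before time `k`. -/
@[reducible] def past {Ω : Type*} {d m b : ℕ} {n : Fin m → ℕ}
    (x₀ : Fin m → Ω → EuclideanSpace ℝ (Fin d))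
    (S : (i : Fin m) → ℕ → Fin b → Ω → Fin (n i)) (k : ℕ) : MeasurableSpace Ω :=
  (⨆ i, MeasurableSpace.comap (x₀ i) inferInstance) ⊔
    ⨆ i, ⨆ l, ⨆ (_ : l < k), ⨆ r, MeasurableSpace.comap (S i l r) inferInstance

end DRP

end

/-!
All randomness is disposed of by one almost sure statement, and the rest of the argument is
deterministic along each path.

Write `F` for the feasible set and `v i k` for the mixed point of agent `i` at time `k`. The
stochastic statement, `ae_summable_infDist_mix_sq`, is that `∑ k, infDist (v i k) F ^ 2 < ∞` almost
surely. In one step, the squared distance of an agent to `F` changes by terms of order `α k`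
through the gradient, and decreases by the squared distance to the first sampled set. That set is
independent of the past, so set regularity bounds the expected decrease below by a multiple of
`infDist (v i k) F ^ 2`; the linear gradient term `α k * infDist` is absorbed by Young's inequality
and leaves `O(α k ^ 2)`. Doubly stochastic mixing does not increase the sum of the squared distances
over the agents. Summing the recursion gives the claim in expectation, hence almost surely. As the
initial points need not be integrable, all expectations carry the weight
`(1 + ∑ i, infDist (x₀ i) F ^ 2)⁻¹`, which is positive, bounded, and measurable with respect to
every past. The decrease comes from the first projection of each batch; the other ones lose nothing, being
nonexpansive towards points of `F`.

On a path with summable squared distances, the step of an agent differs from its mixed point by a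
square summable error, since projections on supersets of `F` are nonexpansive towards points of `F`.
The product of the weight matrices over sufficiently many windows of joint connectivity has all
entries bounded below (`pow_le_transition`), so it contracts the deviation from the average, which
is therefore square summable too (`summable_disagreement_sq`). With `z k` the point of `F` nearest
to the average, convexity gives for every `y ∈ F`
`∑ i, ‖x i (k + 1) - y‖ ^ 2 ≤ ∑ i, ‖x i k - y‖ ^ 2 - 2 * α k * (f (z k) - f y) + β k`,
with a summable `β` that does not depend on `y` (`sum_norm_step_sub_sq_le`). For a minimizer `y`
the left-hand sums converge and `∑ k, α k * (f (z k) - f y) < ∞`. As `∑ k, α k = ∞`, the values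
`f (z k)` approach the optimal value along a subsequence; a limit point of `z` along it is a
minimizer, and taking it for `y` shows that all agents converge to it
(`exists_forall_tendsto_of_quasiFejer`).
-/

namespace DRP

open Filter Topology MeasureTheory
open scoped RealInnerProductSpace

/-! ### Projections on convex sets -/

theorem dist_eq_infDist_iff_inner_le {H : Type*} [NormedAddCommGroup H] [InnerProductSpace ℝ H]
    {K : Set H} (hK : Convex ℝ K) {x y : H} (hy : y ∈ K) :
    dist x y = Metric.infDist x K ↔ ∀ w ∈ K, ⟪x - y, w - y⟫ ≤ 0 := by
  rw [← norm_eq_iInf_iff_real_inner_le_zero hK hy, Metric.infDist_eq_iInf, dist_eq_norm]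
  simp only [dist_eq_norm]

/-- The Pythagorean inequality for a nearest point `y` of a convex set. -/
theorem norm_sub_sq_add_infDist_sq_le {H : Type*} [NormedAddCommGroup H] [InnerProductSpace ℝ H]
    {K : Set H} (hK : Convex ℝ K) {x y w : H} (hy : y ∈ K)
    (hxy : dist x y = Metric.infDist x K) (hw : w ∈ K) :
    ‖y - w‖ ^ 2 + Metric.infDist x K ^ 2 ≤ ‖x - w‖ ^ 2 := by
  have h := (dist_eq_infDist_iff_inner_le hK hy).1 hxy w hw
  rw [← hxy, dist_eq_norm]
  have h2 : x - w = (x - y) - (w - y) := by abel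
  rw [h2, norm_sub_sq_real (x - y), norm_sub_rev y w]
  linarith

section Proj

variable {d : ℕ} {K : Set (EuclideanSpace ℝ (Fin d))}

/-- The minimizer chosen in the definition of `proj` exists, and it is a nearest point. -/
theorem proj_spec (hc : IsClosed K) (hne : K.Nonempty) (x : EuclideanSpace ℝ (Fin d)) :
    proj K x ∈ K ∧ dist x (proj K x) = Metric.infDist x K := by
  have hex : ∃ y, y ∈ K ∧ IsMinOn (fun v => ‖v - x‖ ^ 2) K y := by
    obtain ⟨y, hy, hd⟩ := hc.exists_infDist_eq_dist hne x
    refine ⟨y, hy, fun v hv => ?_⟩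
    have := Metric.infDist_le_dist_of_mem (x := x) hv
    rw [hd, dist_eq_norm, dist_eq_norm, norm_sub_rev, norm_sub_rev x] at this
    exact pow_le_pow_left₀ (norm_nonneg _) this 2
  obtain ⟨h1, h2⟩ := Classical.epsilon_spec hex
  refine ⟨h1, le_antisymm ?_ (Metric.infDist_le_dist_of_mem h1)⟩
  refine (Metric.le_infDist hne).2 fun v hv => ?_
  have := isMinOn_iff.1 h2 v hv
  rw [dist_eq_norm, dist_eq_norm, norm_sub_rev, norm_sub_rev x v]
  exact le_of_sq_le_sq this (norm_nonneg _)

theorem norm_proj_sub_sq_le (hc : IsClosed K) (hK : Convex ℝ K)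
    (x : EuclideanSpace ℝ (Fin d)) {w : EuclideanSpace ℝ (Fin d)} (hw : w ∈ K) :
    ‖proj K x - w‖ ^ 2 + Metric.infDist x K ^ 2 ≤ ‖x - w‖ ^ 2 :=
  norm_sub_sq_add_infDist_sq_le hK (proj_spec hc ⟨w, hw⟩ x).1 (proj_spec hc ⟨w, hw⟩ x).2 hw

theorem norm_proj_sub_le (hc : IsClosed K) (hK : Convex ℝ K)
    (x : EuclideanSpace ℝ (Fin d)) {w : EuclideanSpace ℝ (Fin d)} (hw : w ∈ K) :
    ‖proj K x - w‖ ≤ ‖x - w‖ := by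
  have := norm_proj_sub_sq_le hc hK x hw
  exact le_of_sq_le_sq (by nlinarith [sq_nonneg (Metric.infDist x K)]) (norm_nonneg _)

/-- The projection is nonexpansive. -/
theorem lipschitzWith_proj (hc : IsClosed K) (hK : Convex ℝ K) (hne : K.Nonempty) :
    LipschitzWith 1 (proj K) := by
  refine LipschitzWith.of_dist_le_mul fun x y => ?_
  obtain ⟨hx, hx'⟩ := proj_spec hc hne x
  obtain ⟨hy, hy'⟩ := proj_spec hc hne y
  have h1 := (dist_eq_infDist_iff_inner_le hK hx).1 hx' _ hy
  have h2 := (dist_eq_infDist_iff_inner_le hK hy).1 hy' _ hx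
  rw [NNReal.coe_one, one_mul, dist_eq_norm, dist_eq_norm]
  set p := proj K x
  set q := proj K y
  have h3 : ‖p - q‖ ^ 2 ≤ ⟪x - y, p - q⟫ := by
    have e1 : ⟪x - p, q - p⟫ = - ⟪x - p, p - q⟫ := by rw [← inner_neg_right, neg_sub]
    have e2 : x - y = (x - p) + (p - q) - (y - q) := by abel
    rw [e2, inner_sub_left, inner_add_left, real_inner_self_eq_norm_sq]
    linarith
  have h4 := real_inner_le_norm (x - y) (p - q)
  by_contra! hlt
  nlinarith [norm_nonneg (x - y)]

theorem continuous_batchProj {b : ℕ} {C : Fin b → Set (EuclideanSpace ℝ (Fin d))}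
    (hc : ∀ r, IsClosed (C r)) (hK : ∀ r, Convex ℝ (C r)) (hne : ∀ r, (C r).Nonempty) :
    Continuous (batchProj b C) := by
  induction b with
  | zero => exact continuous_id
  | succ b ih =>
    exact (lipschitzWith_proj (hc _) (hK _) (hne _)).continuous.comp
      (ih (fun r => hc _) (fun r => hK _) (fun r => hne _))

theorem norm_batchProj_sub_le {b : ℕ} {C : Fin b → Set (EuclideanSpace ℝ (Fin d))}
    (hc : ∀ r, IsClosed (C r)) (hK : ∀ r, Convex ℝ (C r)) (x : EuclideanSpace ℝ (Fin d))
    {w : EuclideanSpace ℝ (Fin d)} (hw : ∀ r, w ∈ C r) :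
    ‖batchProj b C x - w‖ ≤ ‖x - w‖ := by
  induction b with
  | zero => exact le_rfl
  | succ b ih =>
    exact (norm_proj_sub_le (hc _) (hK _) _ (hw _)).trans
      (ih (fun r => hc _) (fun r => hK _) (fun r => hw _))

/-- The first projection of a batch already brings a decrease by the squared distance to the first
set; the others lose nothing. -/
theorem norm_batchProj_sub_sq_add_infDist_sq_le {b : ℕ}
    {C : Fin (b + 1) → Set (EuclideanSpace ℝ (Fin d))}
    (hc : ∀ r, IsClosed (C r)) (hK : ∀ r, Convex ℝ (C r)) (x : EuclideanSpace ℝ (Fin d))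
    {w : EuclideanSpace ℝ (Fin d)} (hw : ∀ r, w ∈ C r) :
    ‖batchProj (b + 1) C x - w‖ ^ 2 + Metric.infDist x (C 0) ^ 2 ≤ ‖x - w‖ ^ 2 := by
  induction b with
  | zero => exact norm_proj_sub_sq_le (hc _) (hK _) _ (hw _)
  | succ b ih =>
    have h1 := norm_proj_sub_le (hc (Fin.last (b + 1))) (hK _)
      (batchProj (b + 1) (fun r => C r.castSucc) x) (hw _)
    have h2 := ih (C := fun r => C r.castSucc) (fun r => hc _) (fun r => hK _) (fun r => hw _)
    exact (add_le_add_left (pow_le_pow_left₀ (norm_nonneg _) h1 2) _).trans h2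

end Proj

/-! ### Convex functions -/

/-- The first-order characterization of convexity: the graph lies above its tangents. -/
theorem _root_.ConvexOn.inner_gradient_le_sub {H : Type*} [NormedAddCommGroup H]
    [InnerProductSpace ℝ H] [CompleteSpace H] {f : H → ℝ} (hf : ConvexOn ℝ Set.univ f) {x : H}
    (hd : DifferentiableAt ℝ f x) (y : H) : ⟪gradient f x, y - x⟫ ≤ f y - f x := by
  have hg : HasDerivAt (fun t : ℝ => f (x + t • (y - x))) ⟪gradient f x, y - x⟫ 0 := by
    have h1 : HasFDerivAt f (fderiv ℝ f x) (x + (0 : ℝ) • (y - x)) := by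
      simpa using hd.hasFDerivAt
    have h2 : HasDerivAt (fun t : ℝ => x + t • (y - x)) (y - x) 0 := by
      simpa using ((hasDerivAt_id (0 : ℝ)).smul_const (y - x)).const_add x
    have := h1.comp_hasDerivAt (0 : ℝ) h2
    rwa [← inner_gradient_left] at this
  have ht := hg.tendsto_slope_zero_right
  refine le_of_tendsto ht ?_
  filter_upwards [Ioo_mem_nhdsGT (show (0 : ℝ) < 1 by norm_num)] with t ht
  have := hf.2 (Set.mem_univ x) (Set.mem_univ y) (sub_nonneg.2 ht.2.le) ht.1.le (by ring)
  have e : (1 - t) • x + t • y = x + t • (y - x) := by module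
  rw [e] at this
  simp only [zero_add, zero_smul, add_zero, smul_eq_mul] at this ⊢
  rw [inv_mul_le_iff₀ ht.1]
  linarith

/-! ### Consensus under doubly stochastic weights -/

section Consensus

/-- If `a (k + B) ≤ q * a k + ε k` with `q < 1`, then `a` is square summable as soon as `ε` is. -/
theorem summable_sq_of_le_mul_add {a ε : ℕ → ℝ} {q : ℝ} {B : ℕ} (ha : ∀ k, 0 ≤ a k)
    (hq : 0 ≤ q) (hq1 : q < 1)
    (h : ∀ k, a (k + B) ≤ q * a k + ε k) (hs : Summable fun k => ε k ^ 2) :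
    Summable fun k => a k ^ 2 := by
  have hq' : 0 < 1 - q := by linarith
  have hsq : ∀ k, a (k + B) ^ 2 ≤ q * a k ^ 2 + ε k ^ 2 / (1 - q) := by
    intro k
    refine (pow_le_pow_left₀ (ha _) (h k) 2).trans ?_
    -- convexity of the square, at the weights `q` and `1 - q`
    have e : q * a k ^ 2 + ε k ^ 2 / (1 - q) - (q * a k + ε k) ^ 2
        = q * ((1 - q) * a k - ε k) ^ 2 / (1 - q) := by
      field_simp
      ring
    have : 0 ≤ q * ((1 - q) * a k - ε k) ^ 2 / (1 - q) := by positivity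
    linarith
  set T := ∑' k, ε k ^ 2
  set C := ∑ k ∈ Finset.range B, a k ^ 2
  refine summable_of_sum_range_le (c := (C + T / (1 - q)) / (1 - q)) (fun k => sq_nonneg _)
    fun n => ?_
  have h1 : ∑ k ∈ Finset.range n, a k ^ 2 ≤ C + ∑ k ∈ Finset.range n, a (k + B) ^ 2 := by
    have : ∑ k ∈ Finset.range n, a k ^ 2 ≤ ∑ k ∈ Finset.range (B + n), a k ^ 2 :=
      Finset.sum_le_sum_of_subset_of_nonneg
        (Finset.range_mono (by omega)) fun _ _ _ => sq_nonneg _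
    rw [Finset.sum_range_add] at this
    simpa [add_comm B] using this
  have h2 : ∑ k ∈ Finset.range n, a (k + B) ^ 2
      ≤ q * ∑ k ∈ Finset.range n, a k ^ 2 + (∑ k ∈ Finset.range n, ε k ^ 2) / (1 - q) := by
    rw [Finset.mul_sum, Finset.sum_div, ← Finset.sum_add_distrib]
    exact Finset.sum_le_sum fun k _ => hsq k
  have h3 : (∑ k ∈ Finset.range n, ε k ^ 2) / (1 - q) ≤ T / (1 - q) :=
    div_le_div_of_nonneg_right (hs.sum_le_tsum _ fun _ _ => sq_nonneg _) hq'.le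
  rw [le_div_iff₀ hq']
  linarith

variable {d m : ℕ}

theorem mix_mul (A B : Matrix (Fin m) (Fin m) ℝ) (x : Fin m → EuclideanSpace ℝ (Fin d)) :
    mix (A * B) x = mix A (mix B x) := by
  funext i
  simp only [mix, Matrix.mul_apply, Finset.smul_sum, Finset.sum_smul, mul_smul]
  exact Finset.sum_comm

theorem mix_add (A : Matrix (Fin m) (Fin m) ℝ) (x y : Fin m → EuclideanSpace ℝ (Fin d)) :
    mix A (x + y) = mix A x + mix A y := by
  funext i
  simp [mix, smul_add, Finset.sum_add_distrib]

theorem mix_one (x : Fin m → EuclideanSpace ℝ (Fin d)) :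
    mix (1 : Matrix (Fin m) (Fin m) ℝ) x = x := by
  funext i
  simp [mix, Matrix.one_apply]

theorem mix_sub_const {A : Matrix (Fin m) (Fin m) ℝ} (hrow : ∀ i, ∑ j, A i j = 1)
    (x : Fin m → EuclideanSpace ℝ (Fin d)) (c : EuclideanSpace ℝ (Fin d)) (i : Fin m) :
    mix A x i - c = mix A (fun j => x j - c) i := by
  simp [mix, smul_sub, Finset.sum_sub_distrib, ← Finset.sum_smul, hrow]

theorem norm_mix_sub_le {A : Matrix (Fin m) (Fin m) ℝ} (hA : ∀ i j, 0 ≤ A i j)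
    (hrow : ∀ i, ∑ j, A i j = 1) (x : Fin m → EuclideanSpace ℝ (Fin d))
    (c : EuclideanSpace ℝ (Fin d)) (i : Fin m) :
    ‖mix A x i - c‖ ≤ ∑ j, A i j * ‖x j - c‖ := by
  rw [mix_sub_const hrow]
  refine (norm_sum_le _ _).trans_eq (Finset.sum_congr rfl fun j _ => ?_)
  rw [norm_smul, Real.norm_of_nonneg (hA i j)]

/-- Averaging with doubly stochastic weights does not increase the sum of the squared distances
to a point. -/
theorem sum_norm_mix_sub_sq_le {A : Matrix (Fin m) (Fin m) ℝ} (hA : ∀ i j, 0 ≤ A i j)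
    (hrow : ∀ i, ∑ j, A i j = 1) (hcol : ∀ j, ∑ i, A i j = 1)
    (x : Fin m → EuclideanSpace ℝ (Fin d)) (c : EuclideanSpace ℝ (Fin d)) :
    ∑ i, ‖mix A x i - c‖ ^ 2 ≤ ∑ j, ‖x j - c‖ ^ 2 := by
  have h : ∀ i, ‖mix A x i - c‖ ^ 2 ≤ ∑ j, A i j * ‖x j - c‖ ^ 2 := fun i =>
    (pow_le_pow_left₀ (norm_nonneg _) (norm_mix_sub_le hA hrow x c i) 2).trans
      (Real.pow_arith_mean_le_arith_mean_pow _ _ _ (fun j _ => hA i j) (hrow i)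
        (fun _ _ => norm_nonneg _) 2)
  refine (Finset.sum_le_sum fun i _ => h i).trans_eq ?_
  rw [Finset.sum_comm]
  exact Finset.sum_congr rfl fun j _ => by rw [← Finset.sum_mul, hcol, one_mul]

theorem norm_mix_le {A : Matrix (Fin m) (Fin m) ℝ} (hA : ∀ i j, 0 ≤ A i j)
    (hrow : ∀ i, ∑ j, A i j = 1) (x : Fin m → EuclideanSpace ℝ (Fin d)) :
    ‖mix A x‖ ≤ ‖x‖ := by
  refine (pi_norm_le_iff_of_nonneg (norm_nonneg _)).2 fun i => ?_
  have := norm_mix_sub_le hA hrow x 0 i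
  simp only [sub_zero] at this
  refine this.trans ((Finset.sum_le_sum fun j _ =>
    mul_le_mul_of_nonneg_left (norm_le_pi_norm x j) (hA i j)).trans_eq ?_)
  rw [← Finset.sum_mul, hrow, one_mul]

/-- The average of the vectors `x i`. -/
noncomputable def avg (x : Fin m → EuclideanSpace ℝ (Fin d)) : EuclideanSpace ℝ (Fin d) :=
  (m : ℝ)⁻¹ • ∑ i, x i

/-- The largest distance of one of the vectors `x i` to their average: the norm is the
supremum norm on the product space. -/
noncomputable def disagreement (x : Fin m → EuclideanSpace ℝ (Fin d)) : ℝ :=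
  ‖fun i => x i - avg x‖

theorem disagreement_fin_zero (x : Fin 0 → EuclideanSpace ℝ (Fin d)) : disagreement x = 0 :=
  norm_eq_zero.2 (Subsingleton.elim _ _)

theorem disagreement_nonneg (x : Fin m → EuclideanSpace ℝ (Fin d)) : 0 ≤ disagreement x :=
  norm_nonneg _

theorem norm_sub_avg_le (x : Fin m → EuclideanSpace ℝ (Fin d)) (i : Fin m) :
    ‖x i - avg x‖ ≤ disagreement x :=
  norm_le_pi_norm (fun i => x i - avg x) i

theorem avg_mix {A : Matrix (Fin m) (Fin m) ℝ} (hcol : ∀ j, ∑ i, A i j = 1)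
    (x : Fin m → EuclideanSpace ℝ (Fin d)) : avg (mix A x) = avg x := by
  simp only [avg, mix]
  rw [Finset.sum_comm]
  simp [← Finset.sum_smul, hcol]

theorem avg_add (x y : Fin m → EuclideanSpace ℝ (Fin d)) : avg (x + y) = avg x + avg y := by
  simp [avg, Finset.sum_add_distrib]

theorem sum_sub_avg (x : Fin m → EuclideanSpace ℝ (Fin d)) : ∑ i, (x i - avg x) = 0 := by
  rcases Nat.eq_zero_or_pos m with rfl | hm
  · simp
  · have : (m : ℝ) ≠ 0 := by positivity
    rw [Finset.sum_sub_distrib, Finset.sum_const, Finset.card_univ, Fintype.card_fin, avg,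
      ← Nat.cast_smul_eq_nsmul ℝ, smul_smul, mul_inv_cancel₀ this, one_smul, sub_self]

theorem norm_avg_le (x : Fin m → EuclideanSpace ℝ (Fin d)) : ‖avg x‖ ≤ ‖x‖ := by
  rcases Nat.eq_zero_or_pos m with rfl | hm
  · simp [avg]
  · have : (0 : ℝ) < m := by positivity
    rw [avg, norm_smul, norm_inv, Real.norm_of_nonneg this.le, inv_mul_le_iff₀ this]
    refine (norm_sum_le _ _).trans ((Finset.sum_le_sum fun i _ => norm_le_pi_norm x i).trans ?_)
    simp

theorem disagreement_add_le (x y : Fin m → EuclideanSpace ℝ (Fin d)) :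
    disagreement (x + y) ≤ disagreement x + 2 * ‖y‖ := by
  have e : (fun i => (x + y) i - avg (x + y))
      = (fun i => x i - avg x) + (y - fun _ => avg y) := by
    funext i
    simp only [avg_add, Pi.add_apply, Pi.sub_apply]
    abel
  have h1 : ‖(fun _ => avg y : Fin m → EuclideanSpace ℝ (Fin d))‖ ≤ ‖y‖ :=
    (pi_norm_le_iff_of_nonneg (norm_nonneg _)).2 fun _ => norm_avg_le y
  rw [disagreement, e]
  refine (norm_add_le _ _).trans ?_
  have h2 := norm_sub_le y (fun _ => avg y)
  rw [disagreement]
  linarith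

/-- A doubly stochastic matrix with entries at least `δ` contracts the disagreement: on vectors
with zero sum it acts like the matrix whose entries are smaller by `δ`, and that matrix has row
sums `1 - m * δ`. -/
theorem disagreement_mix_le {A : Matrix (Fin m) (Fin m) ℝ} {δ : ℝ} (hA : ∀ i j, δ ≤ A i j)
    (hrow : ∀ i, ∑ j, A i j = 1) (hcol : ∀ j, ∑ i, A i j = 1)
    (x : Fin m → EuclideanSpace ℝ (Fin d)) :
    disagreement (mix A x) ≤ (1 - m * δ) * disagreement x := by
  rcases Nat.eq_zero_or_pos m with rfl | hm
  · simp [disagreement_fin_zero]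
  have hsum : ∀ i, ∑ j, (A i j - δ) = 1 - m * δ := fun i => by
    simp [Finset.sum_sub_distrib, hrow]
  have hnn : 0 ≤ 1 - m * δ := by
    rw [← hsum ⟨0, hm⟩]
    exact Finset.sum_nonneg fun j _ => sub_nonneg.2 (hA _ j)
  refine (pi_norm_le_iff_of_nonneg (mul_nonneg hnn (disagreement_nonneg x))).2 fun i => ?_
  rw [avg_mix hcol, mix_sub_const hrow]
  have e : mix A (fun j => x j - avg x) i = ∑ j, (A i j - δ) • (x j - avg x) := by
    simp only [mix, sub_smul (A _ _) δ, Finset.sum_sub_distrib (fun j => A i j • _)]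
    rw [← Finset.smul_sum, sum_sub_avg, smul_zero, sub_zero]
  rw [e, ← hsum i, Finset.sum_mul]
  refine (norm_sum_le _ _).trans (Finset.sum_le_sum fun j _ => ?_)
  rw [norm_smul, Real.norm_of_nonneg (sub_nonneg.2 (hA i j))]
  exact mul_le_mul_of_nonneg_left (norm_sub_avg_le x j) (sub_nonneg.2 (hA i j))

/-- The product `W (k + t - 1) * ⋯ * W k` of `t` consecutive weight matrices. -/
noncomputable def transition (W : ℕ → Matrix (Fin m) (Fin m) ℝ) (k : ℕ) : ℕ → Matrix (Fin m) (Fin m) ℝ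
  | 0 => 1
  | t + 1 => W (k + t) * transition W k t

section Transition

variable {W : ℕ → Matrix (Fin m) (Fin m) ℝ}

theorem transition_nonneg (hW : ∀ k i j, 0 ≤ W k i j) (k t : ℕ) (i j : Fin m) :
    0 ≤ transition W k t i j := by
  induction t generalizing i with
  | zero => rw [transition, Matrix.one_apply]; split_ifs <;> simp
  | succ t ih =>
    rw [transition, Matrix.mul_apply]
    exact Finset.sum_nonneg fun l _ => mul_nonneg (hW _ _ _) (ih l)

theorem sum_transition_row (hrow : ∀ k i, ∑ j, W k i j = 1) (k t : ℕ) (i : Fin m) :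
    ∑ j, transition W k t i j = 1 := by
  induction t generalizing i with
  | zero => simp [transition, Matrix.one_apply]
  | succ t ih =>
    simp only [transition, Matrix.mul_apply]
    rw [Finset.sum_comm]
    simp [← Finset.mul_sum, ih, hrow]

theorem sum_transition_col (hcol : ∀ k j, ∑ i, W k i j = 1) (k t : ℕ) (j : Fin m) :
    ∑ i, transition W k t i j = 1 := by
  induction t with
  | zero => simp [transition, Matrix.one_apply]
  | succ t ih =>
    simp only [transition, Matrix.mul_apply]
    rw [Finset.sum_comm]
    simp [← Finset.sum_mul, ih, hcol]

/-- If `l` has received weight from `j` after `t` steps, then so has, one step later, every `i` that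
listens to `l`. -/
theorem pow_le_transition_succ (hW : ∀ k i j, 0 ≤ W k i j) {η : ℝ} (hη : 0 ≤ η) {k t : ℕ}
    {i l j : Fin m} (hil : η ≤ W (k + t) i l) (hlj : η ^ t ≤ transition W k t l j) :
    η ^ (t + 1) ≤ transition W k (t + 1) i j := by
  rw [transition, Matrix.mul_apply, pow_succ']
  refine (mul_le_mul hil hlj (pow_nonneg hη _) (hW _ _ _)).trans ?_
  exact Finset.single_le_sum (f := fun l => W (k + t) i l * transition W k t l j)
    (fun l _ => mul_nonneg (hW _ _ _) (transition_nonneg hW _ _ _ _)) (Finset.mem_univ l)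

/-- Over `Q * m` steps the information of every agent reaches every agent: the set of agents
reached from `j` never shrinks, and it grows during each window of length `Q` until it is
everything, since the union graph of the window has an edge that leaves it. -/
theorem pow_le_transition (hW : ∀ k i j, 0 ≤ W k i j) {η : ℝ} (hη : 0 ≤ η)
    {E : ℕ → Digraph (Fin m)} (hE : ∀ k i, (E k).Adj i i)
    (hWE : ∀ k i j, (E k).Adj i j → η ≤ W k i j) {Q : ℕ}
    (hQ : ∀ k, StronglyConnected (⨆ l ∈ Finset.range Q, E (k + l))) (k : ℕ) (i j : Fin m) :
    η ^ (Q * m) ≤ transition W k (Q * m) i j := by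
  classical
  let R : ℕ → Finset (Fin m) := fun t =>
    Finset.univ.filter fun i => η ^ t ≤ transition W k t i j
  have hR : ∀ t i, i ∈ R t ↔ η ^ t ≤ transition W k t i j := fun t i => by simp [R]
  have hj : j ∈ R 0 := by simp [hR, transition]
  have hmono : Monotone R := monotone_nat_of_le_succ fun t i hi => by
    rw [hR] at hi ⊢
    exact pow_le_transition_succ hW hη (hWE _ _ _ (hE _ i)) hi
  have hgrow : ∀ t, R t = Finset.univ ∨ (R t).card < (R (t + Q)).card := by
    intro t
    by_cases hu : R t = Finset.univ
    · exact Or.inl hu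
    right
    obtain ⟨i₀, hi₀⟩ : ∃ i, i ∉ R t := by
      by_contra! h
      exact hu (Finset.eq_univ_iff_forall.2 h)
    have hedge : ∃ i l, i ∉ R t ∧ l ∈ R t ∧ (⨆ s ∈ Finset.range Q, E (k + t + s)).Adj i l := by
      by_contra! hno
      have : ∀ l, Relation.ReflTransGen (⨆ s ∈ Finset.range Q, E (k + t + s)).Adj i₀ l →
          l ∉ R t := by
        intro l hl
        induction hl with
        | refl => exact hi₀
        | tail _ hbc ih => exact fun hc => hno _ _ ih hc hbc
      exact this j (hQ (k + t) i₀ j) (hmono (Nat.zero_le t) hj)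
    obtain ⟨i, l, hi, hl, hadj⟩ := hedge
    simp only [Digraph.iSup_adj, Finset.mem_range, exists_prop] at hadj
    obtain ⟨s, hs, hadj⟩ := hadj
    have h1 : l ∈ R (t + s) := hmono (Nat.le_add_right t s) hl
    have h2 : i ∈ R (t + s + 1) := by
      rw [hR] at h1 ⊢
      exact pow_le_transition_succ hW hη (hWE _ _ _ (by rwa [← add_assoc])) h1
    have h3 : i ∈ R (t + Q) := hmono (by omega) h2
    exact Finset.card_lt_card ⟨hmono (Nat.le_add_right t Q), fun h => hi (h h3)⟩
  have hcard : ∀ s, R (Q * s) = Finset.univ ∨ s < (R (Q * s)).card := by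
    intro s
    induction s with
    | zero => exact Or.inr (Finset.card_pos.2 ⟨j, by simpa using hj⟩)
    | succ s ih =>
      have hle : R (Q * s) ≤ R (Q * (s + 1)) := hmono (Nat.mul_le_mul_left _ (Nat.le_succ s))
      rcases hgrow (Q * s) with h | h
      · exact Or.inl (Finset.univ_subset_iff.1 (h ▸ hle))
      · rcases ih with ih | ih
        · exact Or.inl (Finset.univ_subset_iff.1 (ih ▸ hle))
        · right
          rw [Nat.mul_succ]
          omega
  have huniv : R (Q * m) = Finset.univ := by
    rcases hcard m with h | h
    · exact h
    · exact absurd (Finset.card_le_univ (R (Q * m))) (by simpa using h)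
  exact (hR _ i).1 (huniv ▸ Finset.mem_univ i)

/-- A perturbed averaging sequence stays close to the unperturbed one that starts at time `k`. -/
theorem norm_sub_mix_transition_le (hW : ∀ k i j, 0 ≤ W k i j) (hrow : ∀ k i, ∑ j, W k i j = 1)
    {x e : ℕ → Fin m → EuclideanSpace ℝ (Fin d)} (hx : ∀ k, x (k + 1) = mix (W k) (x k) + e k)
    (k t : ℕ) :
    ‖x (k + t) - mix (transition W k t) (x k)‖ ≤ ∑ l ∈ Finset.range t, ‖e (k + l)‖ := by
  induction t with
  | zero => simp [transition, mix_one]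
  | succ t ih =>
    have e1 : x (k + (t + 1)) - mix (transition W k (t + 1)) (x k)
        = mix (W (k + t)) (x (k + t) - mix (transition W k t) (x k)) + e (k + t) := by
      have := mix_add (W (k + t)) (x (k + t) - mix (transition W k t) (x k))
        (mix (transition W k t) (x k))
      rw [sub_add_cancel] at this
      rw [← add_assoc, hx, this, transition, mix_mul]
      abel
    rw [e1, Finset.sum_range_succ]
    have h1 := norm_mix_le (hW (k + t)) (hrow (k + t))
      (x (k + t) - mix (transition W k t) (x k))
    have h2 := norm_add_le (mix (W (k + t)) (x (k + t) - mix (transition W k t) (x k)))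
      (e (k + t))
    linarith

/-- Perturbed consensus: square summable perturbations leave a square summable disagreement. -/
theorem summable_disagreement_sq (hW : ∀ k i j, 0 ≤ W k i j) (hrow : ∀ k i, ∑ j, W k i j = 1)
    (hcol : ∀ k j, ∑ i, W k i j = 1) {η : ℝ} (hη : 0 < η)
    {E : ℕ → Digraph (Fin m)} (hE : ∀ k i, (E k).Adj i i)
    (hWE : ∀ k i j, (E k).Adj i j → η ≤ W k i j) {Q : ℕ}
    (hQ : ∀ k, StronglyConnected (⨆ l ∈ Finset.range Q, E (k + l)))
    {x e : ℕ → Fin m → EuclideanSpace ℝ (Fin d)} (hx : ∀ k, x (k + 1) = mix (W k) (x k) + e k)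
    (he : Summable fun k => ‖e k‖ ^ 2) :
    Summable fun k => disagreement (x k) ^ 2 := by
  rcases Nat.eq_zero_or_pos m with rfl | hm
  · simp [disagreement_fin_zero]
  set B := Q * m
  have hent := pow_le_transition hW hη.le hE hWE hQ
  have hq : 0 ≤ 1 - m * η ^ B := by
    have := Finset.sum_le_sum fun j (_ : j ∈ Finset.univ) => hent 0 ⟨0, hm⟩ j
    rw [sum_transition_row hrow] at this
    simpa using this
  have hq1 : 1 - m * η ^ B < 1 := by
    have : (0 : ℝ) < m := by exact_mod_cast hm
    have : 0 < m * η ^ B := by positivity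
    linarith
  refine summable_sq_of_le_mul_add (B := B)
    (ε := fun k => 2 * ∑ l ∈ Finset.range B, ‖e (k + l)‖)
    (fun k => disagreement_nonneg _) hq hq1 (fun k => ?_) ?_
  · have h1 := disagreement_add_le (mix (transition W k B) (x k))
      (x (k + B) - mix (transition W k B) (x k))
    rw [add_sub_cancel] at h1
    have h2 := norm_sub_mix_transition_le hW hrow hx k B
    have h3 := disagreement_mix_le (hent k) (sum_transition_row hrow k B)
      (sum_transition_col hcol k B) (x k)
    linarith
  · have hs : Summable fun k => ∑ l ∈ Finset.range B, ‖e (k + l)‖ ^ 2 :=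
      summable_sum fun l _ => (summable_nat_add_iff (f := fun k => ‖e k‖ ^ 2) l).2 he
    refine Summable.of_nonneg_of_le (fun k => sq_nonneg _) (fun k => ?_) (hs.mul_left (4 * (B : ℝ)))
    have := sq_sum_le_card_mul_sum_sq (s := Finset.range B) (f := fun l => ‖e (k + l)‖)
    rw [Finset.card_range] at this
    rw [mul_pow]
    linarith

end Transition

end Consensus

/-! ### Summability along deterministic sequences -/

section Sequences

/-- A deterministic supermartingale argument: a nonnegative sequence that decreases up to a
summable error converges, and its decrements are summable. -/
theorem exists_tendsto_and_summable_of_le_sub_add {a b β : ℕ → ℝ} (ha : ∀ k, 0 ≤ a k)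
    (hb : ∀ k, 0 ≤ b k) (hβ : ∀ k, 0 ≤ β k) (hs : Summable β)
    (h : ∀ k, a (k + 1) ≤ a k - b k + β k) : (∃ l, Tendsto a atTop (𝓝 l)) ∧ Summable b := by
  constructor
  · have hanti : Antitone fun k => a k - ∑ l ∈ Finset.range k, β l :=
      antitone_nat_of_succ_le fun k => by
        rw [Finset.sum_range_succ]
        linarith [h k, hb k]
    have hbdd : BddBelow (Set.range fun k => a k - ∑ l ∈ Finset.range k, β l) := by
      refine ⟨-∑' l, β l, ?_⟩
      rintro _ ⟨k, rfl⟩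
      have := hs.sum_le_tsum (Finset.range k) fun _ _ => hβ _
      dsimp only
      linarith [ha k]
    have := (tendsto_atTop_ciInf hanti hbdd).add hs.hasSum.tendsto_sum_nat
    simp only [sub_add_cancel] at this
    exact ⟨_, this⟩
  · refine summable_of_sum_range_le (c := a 0 + ∑' l, β l) hb fun n => ?_
    have key : ∑ k ∈ Finset.range n, b k ≤ a 0 - a n + ∑ k ∈ Finset.range n, β k := by
      induction n with
      | zero => simp
      | succ n ih =>
        rw [Finset.sum_range_succ, Finset.sum_range_succ]
        linarith [h n]
    linarith [ha n, hs.sum_le_tsum (Finset.range n) fun _ _ => hβ _]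

/-- Weights with a divergent sum force the terms of a summable weighted series to be small
infinitely often. -/
theorem frequently_lt_of_summable_mul {α h : ℕ → ℝ} (hα : ∀ k, 0 < α k)
    (hα_sum : Tendsto (fun N => ∑ k ∈ Finset.range N, α k) atTop atTop)
    (hs : Summable fun k => α k * h k) {ε : ℝ} (hε : 0 < ε) : ∃ᶠ k in atTop, h k < ε := by
  intro hev
  obtain ⟨K, hK⟩ := eventually_atTop.1 hev
  have hsα : Summable fun k => α (k + K) := by
    refine Summable.of_nonneg_of_le (fun k => (hα _).le) (fun k => ?_)
      (((summable_nat_add_iff (f := fun k => α k * h k) K).2 hs).mul_right ε⁻¹)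
    have : ε ≤ h (k + K) := not_lt.1 (hK _ (Nat.le_add_left K k))
    rw [← div_eq_mul_inv, le_div_iff₀ hε]
    exact mul_le_mul_of_nonneg_left this (hα _).le
  exact not_tendsto_nhds_of_tendsto_atTop hα_sum _
    ((summable_nat_add_iff (f := α) K).1 hsα).hasSum.tendsto_sum_nat

end Sequences

/-! ### Gradient steps -/

section GradientStep

variable {H : Type*} [NormedAddCommGroup H] [InnerProductSpace ℝ H] [CompleteSpace H]

/-- One gradient step seen from a feasible point `y`, compared with the value of `f` at another
feasible point `z`. -/
theorem norm_gradient_step_sub_sq_le {f : H → ℝ} (hf : ConvexOn ℝ Set.univ f)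
    (hd : Differentiable ℝ f) {G : ℝ} {z : H} (hz : ‖gradient f z‖ ≤ G) {a : ℝ} (ha : 0 ≤ a)
    (v y : H) :
    ‖v - a • gradient f v - y‖ ^ 2 ≤
      ‖v - y‖ ^ 2 - 2 * a * (f z - f y) + 2 * a * G * ‖v - z‖ + a ^ 2 * ‖gradient f v‖ ^ 2 := by
  have h1 := hf.inner_gradient_le_sub (hd v) y
  have h2 := hf.inner_gradient_le_sub (hd z) v
  have h3 : -(G * ‖v - z‖) ≤ ⟪gradient f z, v - z⟫ :=
    (neg_le_neg (mul_le_mul_of_nonneg_right hz (norm_nonneg _))).trans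
      (neg_le_of_abs_le (abs_real_inner_le_norm _ _))
  have e : v - a • gradient f v - y = (v - y) - a • gradient f v := by abel
  have e2 : ⟪v - y, gradient f v⟫ = -⟪gradient f v, y - v⟫ := by
    rw [← inner_neg_right, neg_sub, real_inner_comm]
  rw [e, norm_sub_sq_real, norm_smul, Real.norm_of_nonneg ha, inner_smul_right, e2, mul_pow]
  have h4 : f z - f y - G * ‖v - z‖ ≤ -⟪gradient f v, y - v⟫ := by linarith
  nlinarith [mul_le_mul_of_nonneg_left h4 ha]

end GradientStep

/-! ### Convergence along one path -/

section Deterministic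

variable {d m : ℕ} {F : Set (EuclideanSpace ℝ (Fin d))}

theorem norm_le_add_mul_infDist (hF : IsClosed F) (hne : F.Nonempty) {G L : ℝ}
    {g : EuclideanSpace ℝ (Fin d) → EuclideanSpace ℝ (Fin d)}
    (hG : ∀ x ∈ F, ‖g x‖ ≤ G) (hL : ∀ x y, ‖g x - g y‖ ≤ L * ‖x - y‖)
    (v : EuclideanSpace ℝ (Fin d)) : ‖g v‖ ≤ G + L * Metric.infDist v F := by
  obtain ⟨z, hz, hvz⟩ := hF.exists_infDist_eq_dist hne v
  rw [hvz, dist_eq_norm]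
  have := norm_add_le (g z) (g v - g z)
  rw [add_sub_cancel] at this
  linarith [hG z hz, hL v z]

/-- The squared length of a gradient step, bounded by terms that are summable along the iteration:
on the feasible set the gradient is bounded, and off it the Lipschitz constant takes over. -/
theorem sq_mul_norm_gradient_sq_le (hF : IsClosed F) (hne : F.Nonempty) {G L a T : ℝ}
    {g : EuclideanSpace ℝ (Fin d) → EuclideanSpace ℝ (Fin d)}
    (hG : ∀ x ∈ F, ‖g x‖ ≤ G) (hL : ∀ x y, ‖g x - g y‖ ≤ L * ‖x - y‖) (haT : a ^ 2 ≤ T)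
    (v : EuclideanSpace ℝ (Fin d)) :
    a ^ 2 * ‖g v‖ ^ 2 ≤ 2 * G ^ 2 * a ^ 2 + 2 * L ^ 2 * T * Metric.infDist v F ^ 2 := by
  have h1 : ‖g v‖ ^ 2 ≤ 2 * G ^ 2 + 2 * (L * Metric.infDist v F) ^ 2 :=
    (pow_le_pow_left₀ (norm_nonneg _) (norm_le_add_mul_infDist hF hne hG hL v) 2).trans
      (by nlinarith [sq_nonneg (G - L * Metric.infDist v F)])
  have h2 := mul_le_mul_of_nonneg_left h1 (sq_nonneg a)
  have h3 := mul_le_mul_of_nonneg_right haT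
    (show 0 ≤ 2 * L ^ 2 * Metric.infDist v F ^ 2 by positivity)
  linarith

/-- The displacement of an agent in a nonexpansive step after a gradient step is controlled by its
distance to the feasible set. -/
theorem norm_sub_sq_le_of_step (hF : IsClosed F) (hne : F.Nonempty) {G L a T : ℝ} (ha : 0 ≤ a)
    {g : EuclideanSpace ℝ (Fin d) → EuclideanSpace ℝ (Fin d)}
    (hG : ∀ x ∈ F, ‖g x‖ ≤ G) (hL : ∀ x y, ‖g x - g y‖ ≤ L * ‖x - y‖) (haT : a ^ 2 ≤ T)
    {v w : EuclideanSpace ℝ (Fin d)} (hw : ∀ y ∈ F, ‖w - y‖ ≤ ‖v - a • g v - y‖) :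
    ‖w - v‖ ^ 2 ≤ (8 + 4 * L ^ 2 * T) * Metric.infDist v F ^ 2 + 4 * G ^ 2 * a ^ 2 := by
  obtain ⟨z, hz, hvz⟩ := hF.exists_infDist_eq_dist hne v
  rw [dist_eq_norm] at hvz
  have h1 := hw z hz
  have h2 : ‖v - a • g v - z‖ ≤ Metric.infDist v F + a * ‖g v‖ := by
    have e : v - a • g v - z = (v - z) - a • g v := by abel
    rw [e]
    refine (norm_sub_le _ _).trans_eq ?_
    rw [norm_smul, Real.norm_of_nonneg ha, ← hvz]
  have h3 : ‖w - v‖ ≤ 2 * Metric.infDist v F + a * ‖g v‖ := by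
    have := norm_sub_le_norm_sub_add_norm_sub w z v
    rw [norm_sub_rev z, ← hvz] at this
    linarith
  have h4 := pow_le_pow_left₀ (norm_nonneg _) h3 2
  have h5 := sq_nonneg (2 * Metric.infDist v F - a * ‖g v‖)
  have h6 := sq_mul_norm_gradient_sq_le hF hne hG hL haT v
  nlinarith

theorem summable_pi_norm_sq {u : ℕ → Fin m → EuclideanSpace ℝ (Fin d)}
    (hu : ∀ i, Summable fun k => ‖u k i‖ ^ 2) : Summable fun k => ‖u k‖ ^ 2 := by
  refine Summable.of_nonneg_of_le (fun k => sq_nonneg _) (fun k => ?_)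
    (summable_sum fun i (_ : i ∈ Finset.univ) => hu i)
  have : ‖u k‖ ≤ √(∑ i, ‖u k i‖ ^ 2) :=
    (pi_norm_le_iff_of_nonneg (Real.sqrt_nonneg _)).2 fun i => Real.le_sqrt_of_sq_le
      (Finset.single_le_sum (f := fun i => ‖u k i‖ ^ 2)
        (fun _ _ => sq_nonneg _) (Finset.mem_univ i))
  refine (pow_le_pow_left₀ (norm_nonneg _) this 2).trans_eq ?_
  rw [Real.sq_sqrt (Finset.sum_nonneg fun _ _ => sq_nonneg _)]

theorem tendsto_zero_of_summable_sq {u : ℕ → ℝ} (hu : ∀ k, 0 ≤ u k)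
    (hs : Summable fun k => u k ^ 2) : Tendsto u atTop (𝓝 0) := by
  have := (Real.continuous_sqrt.tendsto 0).comp hs.tendsto_atTop_zero
  simpa [Function.comp_def, Real.sqrt_sq (hu _)] using this

/-- The quasi-Fejér inequality, summed over the agents: at every feasible point `y`, with `z`
feasible and close to all the mixed points. -/
theorem sum_norm_step_sub_sq_le (hF : IsClosed F) (hne : F.Nonempty)
    {f : Fin m → EuclideanSpace ℝ (Fin d) → ℝ} (hf : ∀ i, ConvexOn ℝ Set.univ (f i))
    (hd : ∀ i, Differentiable ℝ (f i)) {G L : ℝ} (hG0 : 0 ≤ G)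
    (hL : ∀ i x y, ‖gradient (f i) x - gradient (f i) y‖ ≤ L * ‖x - y‖)
    (hG : ∀ i, ∀ x ∈ F, ‖gradient (f i) x‖ ≤ G)
    {A : Matrix (Fin m) (Fin m) ℝ} (hA : ∀ i j, 0 ≤ A i j)
    (hrow : ∀ i, ∑ j, A i j = 1) (hcol : ∀ j, ∑ i, A i j = 1)
    {a T N : ℝ} (ha : 0 ≤ a) (haT : a ^ 2 ≤ T)
    {x x' : Fin m → EuclideanSpace ℝ (Fin d)} {y z : EuclideanSpace ℝ (Fin d)} (hz : z ∈ F)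
    (hstep : ∀ i, ‖x' i - y‖ ≤ ‖mix A x i - a • gradient (f i) (mix A x i) - y‖)
    (hvz : ∀ i, ‖mix A x i - z‖ ≤ 2 * N + Metric.infDist (mix A x i) F) :
    ∑ i, ‖x' i - y‖ ^ 2 ≤ ∑ i, ‖x i - y‖ ^ 2 - 2 * (a * (∑ i, f i z - ∑ i, f i y))
      + ∑ i, (2 * G * (a ^ 2 + N ^ 2) + G * (a ^ 2 + Metric.infDist (mix A x i) F ^ 2)
        + (2 * G ^ 2 * a ^ 2 + 2 * L ^ 2 * T * Metric.infDist (mix A x i) F ^ 2)) := by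
  have h1 : ∀ i, ‖x' i - y‖ ^ 2 ≤ ‖mix A x i - y‖ ^ 2 - 2 * a * (f i z - f i y)
      + (2 * G * (a ^ 2 + N ^ 2) + G * (a ^ 2 + Metric.infDist (mix A x i) F ^ 2)
        + (2 * G ^ 2 * a ^ 2 + 2 * L ^ 2 * T * Metric.infDist (mix A x i) F ^ 2)) := by
    intro i
    have h2 := pow_le_pow_left₀ (norm_nonneg _) (hstep i) 2
    have h3 := norm_gradient_step_sub_sq_le (hf i) (hd i) (hG i _ hz) ha (mix A x i) y
    have h4 := mul_le_mul_of_nonneg_left (hvz i) (show 0 ≤ 2 * a * G by positivity)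
    have h5 := mul_nonneg hG0 (sq_nonneg (a - N))
    have h6 := mul_nonneg hG0 (sq_nonneg (a - Metric.infDist (mix A x i) F))
    have h7 := sq_mul_norm_gradient_sq_le hF hne (hG i) (hL i) haT (mix A x i)
    linarith
  refine (Finset.sum_le_sum fun i _ => h1 i).trans ?_
  rw [Finset.sum_add_distrib, Finset.sum_sub_distrib, ← Finset.mul_sum,
    Finset.sum_sub_distrib]
  have := sum_norm_mix_sub_sq_le hA hrow hcol x y
  linarith

/-- If the agents follow a feasible sequence `z` and their iterates satisfy a quasi-Fejér
inequality at every feasible point, with summable errors and nonsummable stepsizes, then all of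
them converge to one minimizer. -/
theorem exists_forall_tendsto_of_quasiFejer (hF : IsClosed F)
    {φ : EuclideanSpace ℝ (Fin d) → ℝ} (hφ : Continuous φ)
    (hopt : ∃ y ∈ F, IsMinOn φ F y) {α β : ℕ → ℝ} (hα : ∀ k, 0 < α k)
    (hα_sum : Tendsto (fun N => ∑ k ∈ Finset.range N, α k) atTop atTop)
    (hβ0 : ∀ k, 0 ≤ β k) (hβs : Summable β)
    {x : ℕ → Fin m → EuclideanSpace ℝ (Fin d)} {z : ℕ → EuclideanSpace ℝ (Fin d)}
    (hz : ∀ k, z k ∈ F) (hclose : ∀ i, Tendsto (fun k => x k i - z k) atTop (𝓝 0))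
    (hfejer : ∀ y ∈ F, ∀ k, ∑ i, ‖x (k + 1) i - y‖ ^ 2
      ≤ ∑ i, ‖x k i - y‖ ^ 2 - 2 * (α k * (φ (z k) - φ y)) + β k) :
    ∃ y ∈ F, IsMinOn φ F y ∧ ∀ i, Tendsto (fun k => x k i) atTop (𝓝 y) := by
  obtain ⟨y₀, hy₀, hmin₀⟩ := hopt
  rcases Nat.eq_zero_or_pos m with rfl | hm
  · exact ⟨y₀, hy₀, hmin₀, fun i => i.elim0⟩
  have hφmin : ∀ y ∈ F, IsMinOn φ F y → ∀ k, 0 ≤ φ (z k) - φ y := fun y _ hy k =>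
    sub_nonneg.2 (isMinOn_iff.1 hy _ (hz k))
  have hconv : ∀ y ∈ F, IsMinOn φ F y →
      (∃ l, Tendsto (fun k => ∑ i, ‖x k i - y‖ ^ 2) atTop (𝓝 l)) ∧
        Summable fun k => 2 * (α k * (φ (z k) - φ y)) := fun y hy hymin =>
    exists_tendsto_and_summable_of_le_sub_add
      (fun k => Finset.sum_nonneg fun i _ => sq_nonneg _)
      (fun k => by have := hφmin y hy hymin k; have := (hα k).le; positivity) hβ0 hβs (hfejer y hy)
  obtain ⟨⟨l₀, hl₀⟩, hs₀⟩ := hconv y₀ hy₀ hmin₀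
  -- along a subsequence `z k` converges, and its values approach the optimal value
  have hfreq : ∀ n : ℕ, ∃ᶠ k in atTop, φ (z k) - φ y₀ < 1 / ((n : ℝ) + 1) := fun n =>
    frequently_lt_of_summable_mul hα hα_sum
      ((summable_mul_left_iff two_ne_zero).1 hs₀) Nat.one_div_pos_of_nat
  obtain ⟨s, hs, hslt⟩ := extraction_forall_of_frequently hfreq
  have hbdd : ∃ R, ∀ k, ‖z k‖ ≤ R := by
    let i₀ : Fin m := ⟨0, hm⟩
    obtain ⟨R₁, hR₁⟩ := hl₀.bddAbove_range
    obtain ⟨R₂, hR₂⟩ := (hclose i₀).norm.bddAbove_range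
    refine ⟨R₂ + (1 + R₁) + ‖y₀‖, fun k => ?_⟩
    have h1 : ‖x k i₀ - y₀‖ ^ 2 ≤ R₁ :=
      (Finset.single_le_sum (f := fun i => ‖x k i - y₀‖ ^ 2) (fun _ _ => sq_nonneg _)
        (Finset.mem_univ i₀)).trans (hR₁ ⟨k, rfl⟩)
    have h2 : ‖x k i₀ - z k‖ ≤ R₂ := hR₂ ⟨k, rfl⟩
    have h3 : ‖z k‖ ≤ ‖x k i₀ - z k‖ + ‖x k i₀ - y₀‖ + ‖y₀‖ := by
      have e : z k = -(x k i₀ - z k) + (x k i₀ - y₀) + y₀ := by abel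
      have := norm_add₃_le (a := -(x k i₀ - z k)) (b := x k i₀ - y₀) (c := y₀)
      rwa [← e, norm_neg] at this
    nlinarith [sq_nonneg (‖x k i₀ - y₀‖ - 1)]
  obtain ⟨R, hR⟩ := hbdd
  obtain ⟨y, -, t, ht, hty⟩ := tendsto_subseq_of_bounded (Metric.isBounded_closedBall (x := 0)
    (r := R)) (x := fun n => z (s n)) fun n => by simpa using hR (s n)
  have hyF : y ∈ F := hF.mem_of_tendsto hty (Eventually.of_forall fun n => hz _)
  have hφy : φ y ≤ φ y₀ := by
    have h1 : Tendsto (fun n => φ (z (s (t n))) - φ y₀) atTop (𝓝 (φ y - φ y₀)) :=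
      ((hφ.tendsto y).comp hty).sub_const _
    have h2 : Tendsto (fun n => 1 / ((t n : ℝ) + 1)) atTop (𝓝 0) :=
      tendsto_one_div_add_atTop_nhds_zero_nat.comp ht.tendsto_atTop
    have := le_of_tendsto_of_tendsto' h1 h2 fun n => (hslt (t n)).le
    linarith
  have hymin : IsMinOn φ F y := fun w hw => hφy.trans (hmin₀ hw)
  refine ⟨y, hyF, hymin, fun i => ?_⟩
  -- the convergent sequence of squared distances to `y` vanishes along the subsequence
  obtain ⟨⟨l, hl⟩, -⟩ := hconv y hyF hymin
  have hst : Tendsto (fun n => s (t n)) atTop atTop := hs.tendsto_atTop.comp ht.tendsto_atTop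
  have hsub : Tendsto (fun n => ∑ i, ‖x (s (t n)) i - y‖ ^ 2) atTop (𝓝 0) := by
    have : ∀ i, Tendsto (fun n => ‖x (s (t n)) i - y‖ ^ 2) atTop (𝓝 0) := by
      intro i
      have h1 : Tendsto (fun n => x (s (t n)) i - y) atTop (𝓝 0) := by
        simpa using ((hclose i).comp hst).add (hty.sub_const y)
      simpa using h1.norm.pow 2
    simpa using tendsto_finsetSum Finset.univ fun i _ => this i
  obtain rfl : l = 0 := tendsto_nhds_unique (hl.comp hst) hsub
  have hsq : Tendsto (fun k => ‖x k i - y‖ ^ 2) atTop (𝓝 0) :=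
    squeeze_zero (fun _ => sq_nonneg _) (fun k => Finset.single_le_sum
      (f := fun i => ‖x k i - y‖ ^ 2) (fun _ _ => sq_nonneg _) (Finset.mem_univ i)) hl
  rw [tendsto_iff_norm_sub_tendsto_zero]
  have := (Real.continuous_sqrt.tendsto 0).comp hsq
  simpa [Function.comp_def, Real.sqrt_sq (norm_nonneg _)] using this

/-- The pathwise half of the argument. Along a sequence whose steps are nonexpansive towards the
feasible set after a gradient step, square summability of the distances of the mixed points to the
feasible set forces convergence of all agents to one common minimizer. -/
theorem exists_forall_tendsto_of_summable_infDist_sq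
    (hF : IsClosed F)
    {f : Fin m → EuclideanSpace ℝ (Fin d) → ℝ} (hf : ∀ i, ConvexOn ℝ Set.univ (f i))
    (hd : ∀ i, Differentiable ℝ (f i)) {G L : ℝ} (hG0 : 0 ≤ G)
    (hL : ∀ i x y, ‖gradient (f i) x - gradient (f i) y‖ ≤ L * ‖x - y‖)
    (hG : ∀ i, ∀ x ∈ F, ‖gradient (f i) x‖ ≤ G)
    (hopt : ∃ y ∈ F, IsMinOn (fun y => ∑ i, f i y) F y)
    {W : ℕ → Matrix (Fin m) (Fin m) ℝ} (hW : ∀ k i j, 0 ≤ W k i j)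
    (hrow : ∀ k i, ∑ j, W k i j = 1) (hcol : ∀ k j, ∑ i, W k i j = 1) {η : ℝ} (hη : 0 < η)
    {E : ℕ → Digraph (Fin m)} (hE : ∀ k i, (E k).Adj i i)
    (hWE : ∀ k i j, (E k).Adj i j → η ≤ W k i j) {Q : ℕ}
    (hQ : ∀ k, StronglyConnected (⨆ l ∈ Finset.range Q, E (k + l)))
    {α : ℕ → ℝ} (hα : ∀ k, 0 < α k)
    (hα_sum : Tendsto (fun N => ∑ k ∈ Finset.range N, α k) atTop atTop)
    (hα_sq : Summable fun k => α k ^ 2)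
    {x : ℕ → Fin m → EuclideanSpace ℝ (Fin d)}
    (hstep : ∀ k i, ∀ y ∈ F, ‖x (k + 1) i - y‖ ≤
      ‖mix (W k) (x k) i - α k • gradient (f i) (mix (W k) (x k) i) - y‖)
    (hdist : ∀ i, Summable fun k => Metric.infDist (mix (W k) (x k) i) F ^ 2) :
    ∃ y ∈ F, IsMinOn (fun y => ∑ i, f i y) F y ∧
      ∀ i, Tendsto (fun k => x k i) atTop (𝓝 y) := by
  have hne : F.Nonempty := hopt.imp fun _ h => h.1
  set v : ℕ → Fin m → EuclideanSpace ℝ (Fin d) := fun k => mix (W k) (x k) with hv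
  have hαT : ∀ k, α k ^ 2 ≤ ∑' k, α k ^ 2 := fun k => hα_sq.le_tsum k fun _ _ => sq_nonneg _
  have hNsum : Summable fun k => disagreement (x k) ^ 2 := by
    refine summable_disagreement_sq hW hrow hcol hη hE hWE hQ (e := fun k => x (k + 1) - v k)
      (fun k => by simp [hv]) (summable_pi_norm_sq fun i => ?_)
    exact Summable.of_nonneg_of_le (fun k => sq_nonneg _)
      (fun k => norm_sub_sq_le_of_step hF hne (hα k).le (hG i) (hL i) (hαT k) (hstep k i))
      (((hdist i).mul_left _).add (hα_sq.mul_left _))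
  have hvN : ∀ k i, ‖v k i - avg (x k)‖ ≤ disagreement (x k) := by
    intro k i
    have h1 := norm_sub_avg_le (v k) i
    have h2 := disagreement_mix_le (hW k) (hrow k) (hcol k) (x k)
    rw [avg_mix (hcol k)] at h1
    rw [mul_zero, sub_zero, one_mul] at h2
    exact h1.trans h2
  choose z hz hxz using fun k => hF.exists_infDist_eq_dist hne (avg (x k))
  have hAz : ∀ k i, ‖avg (x k) - z k‖ ≤ disagreement (x k) + Metric.infDist (v k i) F := by
    intro k i
    rw [← dist_eq_norm, ← hxz]
    have := Metric.infDist_le_infDist_add_dist (s := F) (x := avg (x k)) (y := v k i)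
    rw [dist_comm, dist_eq_norm] at this
    linarith [hvN k i]
  refine exists_forall_tendsto_of_quasiFejer hF
    (continuous_finsetSum _ fun i _ => (hd i).continuous) hopt hα hα_sum ?_ ?_ hz ?_
    fun y hy k => sum_norm_step_sub_sq_le hF hne hf hd hG0 hL hG (hW k) (hrow k) (hcol k)
      (hα k).le (hαT k) (hz k) (fun i => hstep k i y hy) (N := disagreement (x k)) fun i => ?_
  · intro k
    have : 0 ≤ ∑' k, α k ^ 2 := tsum_nonneg fun _ => sq_nonneg _
    exact Finset.sum_nonneg fun i _ => by positivity
  · exact summable_sum fun i _ =>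
      ((((hα_sq.add hNsum).mul_left (2 * G)).add ((hα_sq.add (hdist i)).mul_left G)).add
        ((hα_sq.mul_left (2 * G ^ 2)).add ((hdist i).mul_left (2 * L ^ 2 * ∑' k, α k ^ 2))))
  · intro i
    rw [tendsto_zero_iff_norm_tendsto_zero]
    have h2 : Tendsto (fun k => 2 * disagreement (x k) + Metric.infDist (v k i) F)
        atTop (𝓝 0) := by
      simpa using ((tendsto_zero_of_summable_sq (fun _ => disagreement_nonneg _) hNsum).const_mul
        2).add (tendsto_zero_of_summable_sq (fun _ => Metric.infDist_nonneg) (hdist i))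
    refine squeeze_zero (fun _ => norm_nonneg _) (fun k => ?_) h2
    linarith [norm_sub_le_norm_sub_add_norm_sub (x k i) (avg (x k)) (z k),
      norm_sub_avg_le (x k) i, hAz k i]
  · have h := norm_sub_le_norm_sub_add_norm_sub (v k i) (avg (x k)) (z k)
    linarith [hvN k i, hAz k i]

end Deterministic

/-! ### The expected decrease of the distance to the feasible set -/

section Sequences

/-- The recursion of the Robbins–Siegmund theorem, for deterministic sequences. -/
theorem summable_of_add_le_one_add_mul_add {u s a β : ℕ → ℝ} (hu : ∀ k, 0 ≤ u k)
    (hs : ∀ k, 0 ≤ s k) (ha : ∀ k, 0 ≤ a k) (hβ : ∀ k, 0 ≤ β k) (has : Summable a)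
    (hβs : Summable β) (h : ∀ k, u (k + 1) + s k ≤ (1 + a k) * u k + β k) : Summable s := by
  have hbound : ∀ k, u k ≤ Real.exp (∑ l ∈ Finset.range k, a l)
      * (u 0 + ∑ l ∈ Finset.range k, β l) := by
    intro k
    induction k with
    | zero => simp
    | succ k ih =>
      rw [Finset.sum_range_succ, Finset.sum_range_succ, Real.exp_add]
      set e := Real.exp (∑ l ∈ Finset.range k, a l)
      set B := u 0 + ∑ l ∈ Finset.range k, β l
      have he : 1 ≤ e := Real.one_le_exp (Finset.sum_nonneg fun l _ => ha l)
      have hea : 1 + a k ≤ Real.exp (a k) := by linarith [Real.add_one_le_exp (a k)]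
      have h1 : 1 ≤ e * Real.exp (a k) := by nlinarith [ha k]
      have hB : 0 ≤ B := add_nonneg (hu 0) (Finset.sum_nonneg fun l _ => hβ l)
      have h2 : (1 + a k) * u k ≤ Real.exp (a k) * (e * B) :=
        mul_le_mul hea ih (hu k) (Real.exp_pos _).le
      have h3 : β k ≤ e * Real.exp (a k) * β k := le_mul_of_one_le_left (hβ k) h1
      rw [← add_assoc]
      linarith [h k, hs k]
  set M := Real.exp (∑' l, a l) * (u 0 + ∑' l, β l)
  have hM : ∀ k, u k ≤ M := fun k => (hbound k).trans <|
    mul_le_mul (Real.exp_le_exp.2 (has.sum_le_tsum _ fun _ _ => ha _))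
      (by linarith [hβs.sum_le_tsum (Finset.range k) fun _ _ => hβ _])
      (add_nonneg (hu 0) (Finset.sum_nonneg fun l _ => hβ l)) (Real.exp_pos _).le
  have hM0 : 0 ≤ M := (hu 0).trans (hM 0)
  refine (exists_tendsto_and_summable_of_le_sub_add hu hs
    (β := fun k => a k * M + β k) (fun k => add_nonneg (mul_nonneg (ha k) hM0) (hβ k))
    ((has.mul_right M).add hβs) fun k => ?_).2
  have := mul_le_mul_of_nonneg_left (hM k) (ha k)
  linarith [h k]

end Sequences

section Distances

variable {d m : ℕ} {F : Set (EuclideanSpace ℝ (Fin d))}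

/-- Jensen's inequality for the squared distance to a convex set. -/
theorem infDist_mix_sq_le (hF : IsClosed F) (hFc : Convex ℝ F) (hne : F.Nonempty)
    {A : Matrix (Fin m) (Fin m) ℝ} (hA : ∀ i j, 0 ≤ A i j) (hrow : ∀ i, ∑ j, A i j = 1)
    (x : Fin m → EuclideanSpace ℝ (Fin d)) (i : Fin m) :
    Metric.infDist (mix A x i) F ^ 2 ≤ ∑ j, A i j * Metric.infDist (x j) F ^ 2 := by
  choose y hy hxy using fun j => hF.exists_infDist_eq_dist hne (x j)
  have hmem : mix A y i ∈ F := hFc.sum_mem (fun j _ => hA i j) (hrow i) fun j _ => hy j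
  have h1 : Metric.infDist (mix A x i) F ≤ ∑ j, A i j * Metric.infDist (x j) F := by
    refine (Metric.infDist_le_dist_of_mem hmem).trans ?_
    rw [dist_eq_norm, mix, mix, ← Finset.sum_sub_distrib]
    refine (norm_sum_le _ _).trans_eq (Finset.sum_congr rfl fun j _ => ?_)
    rw [← smul_sub, norm_smul, Real.norm_of_nonneg (hA i j), hxy, dist_eq_norm]
  exact (pow_le_pow_left₀ Metric.infDist_nonneg h1 2).trans
    (Real.pow_arith_mean_le_arith_mean_pow _ _ _ (fun j _ => hA i j) (hrow i)
      (fun _ _ => Metric.infDist_nonneg) 2)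

/-- The distance of the gradient step to the feasible set, against that of its starting point. -/
theorem infDist_gradient_step_sq_le {a : ℝ} (ha : 0 ≤ a)
    (v g : EuclideanSpace ℝ (Fin d)) :
    Metric.infDist (v - a • g) F ^ 2 ≤ 2 * Metric.infDist v F ^ 2 + 2 * (a ^ 2 * ‖g‖ ^ 2) ∧
      Metric.infDist v F ^ 2 ≤ 2 * Metric.infDist (v - a • g) F ^ 2
        + 2 * (a ^ 2 * ‖g‖ ^ 2) := by
  have h1 := Metric.infDist_le_infDist_add_dist (s := F) (x := v) (y := v - a • g)
  have h2 := Metric.infDist_le_infDist_add_dist (s := F) (x := v - a • g) (y := v)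
  rw [dist_comm] at h2
  rw [dist_eq_norm, sub_sub_cancel, norm_smul, Real.norm_of_nonneg ha] at h1 h2
  have h3 := pow_le_pow_left₀ Metric.infDist_nonneg h1 2
  have h4 := pow_le_pow_left₀ Metric.infDist_nonneg h2 2
  have h5 := sq_nonneg (Metric.infDist v F - a * ‖g‖)
  have h6 := sq_nonneg (Metric.infDist (v - a • g) F - a * ‖g‖)
  constructor <;> nlinarith

/-- One step of one agent. The squared distance to the feasible set decreases by the squared
distance to the first sampled set; `infDist (v - a • ∇f v) F ^ 2 / c` is a lower bound of the
expectation of the latter. -/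
theorem infDist_batchProj_step_le {n b : ℕ} (hF : IsClosed F) (hne : F.Nonempty)
    {f : EuclideanSpace ℝ (Fin d) → ℝ} (hf : ConvexOn ℝ Set.univ f) (hd : Differentiable ℝ f)
    {G L : ℝ} (hL : ∀ x y, ‖gradient f x - gradient f y‖ ≤ L * ‖x - y‖)
    (hG : ∀ x ∈ F, ‖gradient f x‖ ≤ G)
    {C : Fin n → Set (EuclideanSpace ℝ (Fin d))} (hC : ∀ j, IsClosed (C j))
    (hCc : ∀ j, Convex ℝ (C j)) (hFC : ∀ j, F ⊆ C j) {a c : ℝ} (ha : 0 ≤ a) (hc : 0 < c)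
    (s : Fin (b + 1) → Fin n) (v : EuclideanSpace ℝ (Fin d)) :
    Metric.infDist (batchProj (b + 1) (fun r => C (s r)) (v - a • gradient f v)) F ^ 2
        + Metric.infDist (v - a • gradient f v) (C (s 0)) ^ 2 + (4 * c)⁻¹ * Metric.infDist v F ^ 2
      ≤ (1 + ((1 + c⁻¹) * (2 * G ^ 2 + 2 * L ^ 2) + 4 * c * G ^ 2) * a ^ 2) * Metric.infDist v F ^ 2
        + ((1 + c⁻¹) * (2 * G ^ 2 + 2 * L ^ 2) + 4 * c * G ^ 2) * a ^ 2
        + c⁻¹ * Metric.infDist (v - a • gradient f v) F ^ 2 := by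
  obtain ⟨z, hz, hvz⟩ := hF.exists_infDist_eq_dist hne v
  rw [dist_eq_norm] at hvz
  have h1 := norm_batchProj_sub_sq_add_infDist_sq_le (fun r => hC (s r)) (fun r => hCc (s r))
    (v - a • gradient f v) (fun r => hFC (s r) hz)
  have h2 := norm_gradient_step_sub_sq_le hf hd (hG z hz) ha v z
  have h3 : Metric.infDist (batchProj (b + 1) (fun r => C (s r)) (v - a • gradient f v)) F ^ 2
      ≤ ‖batchProj (b + 1) (fun r => C (s r)) (v - a • gradient f v) - z‖ ^ 2 := by
    rw [← dist_eq_norm]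
    exact pow_le_pow_left₀ Metric.infDist_nonneg (Metric.infDist_le_dist_of_mem hz) 2
  have h4 := (infDist_gradient_step_sq_le (F := F) ha v (gradient f v)).2
  have h5 := sq_mul_norm_gradient_sq_le hF hne hG hL (le_refl (a ^ 2)) v
  rw [← hvz, sub_self, mul_zero, sub_zero] at h2
  set D := Metric.infDist v F
  set R := Metric.infDist (v - a • gradient f v) F
  set g := a ^ 2 * ‖gradient f v‖ ^ 2
  have hc' : 0 < c⁻¹ := inv_pos.2 hc
  have e4 : (4 * c)⁻¹ = c⁻¹ / 4 := by rw [mul_inv]; ring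
  -- Young's inequality, with the weight that leaves half of the decrease
  have h6 : 2 * a * G * D ≤ c⁻¹ / 4 * D ^ 2 + 4 * c * G ^ 2 * a ^ 2 := by
    have e : c⁻¹ / 4 * D ^ 2 + 4 * c * G ^ 2 * a ^ 2 - 2 * a * G * D
        = c⁻¹ / 4 * (D - 4 * c * G * a) ^ 2 := by
      field_simp
      ring
    have : 0 ≤ c⁻¹ / 4 * (D - 4 * c * G * a) ^ 2 := by positivity
    linarith
  have h7 := mul_le_mul_of_nonneg_left h4 (show 0 ≤ c⁻¹ / 2 by positivity)
  have h8 := mul_le_mul_of_nonneg_left h5 (show 0 ≤ 1 + c⁻¹ by positivity)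
  have h9 : 0 ≤ (1 + c⁻¹) * (2 * L ^ 2) * a ^ 2 := by positivity
  have h10 : 0 ≤ ((1 + c⁻¹) * (2 * G ^ 2) + 4 * c * G ^ 2) * a ^ 2 * D ^ 2 := by positivity
  rw [e4]
  linarith

end Distances

section Probability

variable {Ω : Type*} {m₁ mΩ : MeasurableSpace Ω} {P : Measure Ω}

/-- An index drawn independently of `m₁` is averaged out of an expectation of `m₁`-measurable
functions. -/
theorem integral_apply_of_indep [IsProbabilityMeasure P] {n : ℕ} {s : Ω → Fin n} (hs : Measurable s)
    (hind : ProbabilityTheory.Indep (MeasurableSpace.comap s inferInstance) m₁ P)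
    {p : Fin n → ℝ} (hp : ∀ j, P.real {ω | s ω = j} = p j) {g : Fin n → Ω → ℝ}
    (hg : ∀ j, Measurable[m₁] (g j)) (hgi : ∀ j, Integrable (g j) P) :
    ∫ ω, g (s ω) ω ∂P = ∑ j, p j * ∫ ω, g j ω ∂P := by
  have hset : ∀ j, MeasurableSet {ω | s ω = j} := fun j => hs (measurableSet_singleton j)
  have e : ∀ ω, g (s ω) ω = ∑ j, Set.indicator {ω | s ω = j} (fun _ => (1 : ℝ)) ω * g j ω := by
    intro ω
    rw [Finset.sum_eq_single (s ω)]
    · simp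
    · intro j _ hj
      simp [hj.symm]
    · simp
  simp only [e]
  rw [integral_finsetSum]
  · refine Finset.sum_congr rfl fun j _ => ?_
    have hif : ProbabilityTheory.IndepFun
        (Set.indicator {ω | s ω = j} fun _ => (1 : ℝ)) (g j) P := by
      rw [ProbabilityTheory.IndepFun_iff_Indep]
      refine ProbabilityTheory.indep_of_indep_of_le_left
        (ProbabilityTheory.indep_of_indep_of_le_right hind (hg j).comap_le) ?_
      refine Measurable.comap_le ?_
      exact (measurable_const).indicator ⟨{j}, measurableSet_singleton j, rfl⟩
    rw [hif.integral_fun_mul_eq_mul_integral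
      ((measurable_const.indicator (hset j)).aestronglyMeasurable)
      (hgi j).aestronglyMeasurable, integral_indicator_const _ (hset j), hp, smul_eq_mul, mul_one]
  · intro j _
    have : (fun ω => Set.indicator {ω | s ω = j} (fun _ => (1 : ℝ)) ω * g j ω)
        = Set.indicator {ω | s ω = j} (g j) := by
      funext ω
      by_cases h : s ω = j <;> simp [h]
    rw [this]
    exact (hgi j).indicator (hset j)

/-- Nonnegative functions with summable integrals have almost surely a finite sum. -/
theorem ae_summable_of_summable_integral {g : ℕ → Ω → ℝ} (hg0 : ∀ k ω, 0 ≤ g k ω)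
    (hgi : ∀ k, Integrable (g k) P) (hs : Summable fun k => ∫ ω, g k ω ∂P) :
    ∀ᵐ ω ∂P, Summable fun k => g k ω := by
  have h1 : ∫⁻ ω, ∑' k, ENNReal.ofReal (g k ω) ∂P ≠ ⊤ := by
    rw [lintegral_tsum fun k => (hgi k).aemeasurable.ennreal_ofReal]
    simp_rw [← ofReal_integral_eq_lintegral_ofReal (hgi _) (Eventually.of_forall (hg0 _))]
    exact hs.tsum_ofReal_ne_top
  have h2 := ae_lt_top' (AEMeasurable.tsum
    fun k => (hgi k).aemeasurable.ennreal_ofReal) h1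
  filter_upwards [h2] with ω hω
  have := ENNReal.summable_toReal hω.ne
  simpa [ENNReal.toReal_ofReal (hg0 _ ω)] using this

variable {d : ℕ} {F : Set (EuclideanSpace ℝ (Fin d))}

/-- Independence lets the sampled set be averaged out, and set regularity then bounds the expected
squared distance to it from below. -/
theorem integral_infDist_sampled_ge [IsProbabilityMeasure P] {n : ℕ} (hne : F.Nonempty)
    {C : Fin n → Set (EuclideanSpace ℝ (Fin d))} (hFC : ∀ j, F ⊆ C j) {c : ℝ} (hc : 0 < c)
    (hm₁ : m₁ ≤ mΩ) {s : Ω → Fin n} (hs : Measurable s)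
    (hind : ProbabilityTheory.Indep (MeasurableSpace.comap s inferInstance) m₁ P)
    {p : Fin n → ℝ} (hp : ∀ j, P.real {ω | s ω = j} = p j)
    (hreg : ∀ x, Metric.infDist x F ^ 2 ≤ c * ∫ ω, Metric.infDist x (C (s ω)) ^ 2 ∂P)
    {w : Ω → ℝ} (hw : Measurable[m₁] w) (hw0 : ∀ ω, 0 ≤ w ω)
    {ψ : Ω → EuclideanSpace ℝ (Fin d)} (hψm : Measurable[m₁] ψ)
    (hψF : Integrable (fun ω => w ω * Metric.infDist (ψ ω) F ^ 2) P) :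
    Integrable (fun ω => w ω * Metric.infDist (ψ ω) (C (s ω)) ^ 2) P ∧
    c⁻¹ * ∫ ω, w ω * Metric.infDist (ψ ω) F ^ 2 ∂P
      ≤ ∫ ω, w ω * Metric.infDist (ψ ω) (C (s ω)) ^ 2 ∂P := by
  have hdist : ∀ s : Set (EuclideanSpace ℝ (Fin d)), ∀ u : Ω → EuclideanSpace ℝ (Fin d),
      ∀ m₂ : MeasurableSpace Ω, Measurable[m₂] u →
      Measurable[m₂] fun ω => Metric.infDist (u ω) s ^ 2 := fun s u m₂ hu =>
    ((Metric.continuous_infDist_pt s).measurable.comp hu).pow_const 2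
  have hwm : Measurable w := hw.mono hm₁ le_rfl
  have hψC : ∀ j, Integrable (fun ω => w ω * Metric.infDist (ψ ω) (C j) ^ 2) P := by
    intro j
    refine Integrable.mono' hψF
      (hwm.mul ((hdist (C j) ψ m₁ hψm).mono hm₁ le_rfl)).aestronglyMeasurable
      (Eventually.of_forall fun ω => ?_)
    rw [Real.norm_of_nonneg (mul_nonneg (hw0 ω) (sq_nonneg _))]
    exact mul_le_mul_of_nonneg_left (pow_le_pow_left₀ Metric.infDist_nonneg
      (Metric.infDist_le_infDist_of_subset (hFC j) hne) 2) (hw0 ω)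
  have hψS : Integrable (fun ω => w ω * Metric.infDist (ψ ω) (C (s ω)) ^ 2) P := by
    have hmeas : Measurable fun ω => Metric.infDist (ψ ω) (C (s ω)) ^ 2 := by
      have h1 : Measurable fun q : Fin n × EuclideanSpace ℝ (Fin d) =>
          Metric.infDist q.2 (C q.1) ^ 2 :=
        measurable_from_prod_countable_right fun j =>
          (Metric.continuous_infDist_pt (C j)).measurable.pow_const 2
      exact h1.comp (f := fun ω => (s ω, ψ ω)) (hs.prodMk (hψm.mono hm₁ le_rfl))
    refine Integrable.mono' hψF (hwm.mul hmeas).aestronglyMeasurable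
      (Eventually.of_forall fun ω => ?_)
    rw [Real.norm_of_nonneg (mul_nonneg (hw0 ω) (sq_nonneg _))]
    exact mul_le_mul_of_nonneg_left (pow_le_pow_left₀ Metric.infDist_nonneg
      (Metric.infDist_le_infDist_of_subset (hFC _) hne) 2) (hw0 ω)
  refine ⟨hψS, ?_⟩
  have hreg' : ∀ x, Metric.infDist x F ^ 2 ≤ c * ∑ j, p j * Metric.infDist x (C j) ^ 2 := by
    intro x
    have := integral_apply_of_indep hs hind hp
      (g := fun j _ => Metric.infDist x (C j) ^ 2)
      (fun j => measurable_const) (fun j => integrable_const _)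
    have h := hreg x
    rw [this] at h
    simpa using h
  rw [integral_apply_of_indep hs hind hp
    (g := fun j ω => w ω * Metric.infDist (ψ ω) (C j) ^ 2)
    (fun j => hw.mul (hdist (C j) ψ m₁ hψm)) hψC, inv_mul_le_iff₀ hc]
  simp_rw [← integral_const_mul]
  rw [← integral_finsetSum _ fun j _ => (hψC j).const_mul _, ← integral_const_mul]
  refine integral_mono hψF ((integrable_finsetSum _ fun j _ =>
    (hψC j).const_mul _).const_mul _) fun ω => ?_
  have := mul_le_mul_of_nonneg_left (hreg' (ψ ω)) (hw0 ω)
  refine this.trans_eq ?_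
  simp only [Finset.mul_sum]
  exact Finset.sum_congr rfl fun j _ => by ring

/-- The expected decrease of the squared distance to the feasible set in one step of one agent,
under a bounded nonnegative weight that is measurable with respect to the past. -/
theorem integral_infDist_step_le [IsProbabilityMeasure P] {n b : ℕ} (hF : IsClosed F)
    (hne : F.Nonempty)
    {f : EuclideanSpace ℝ (Fin d) → ℝ} (hf : ConvexOn ℝ Set.univ f) (hd : Differentiable ℝ f)
    {G L : ℝ} (hgc : Continuous (gradient f))
    (hL : ∀ x y, ‖gradient f x - gradient f y‖ ≤ L * ‖x - y‖)
    (hG : ∀ x ∈ F, ‖gradient f x‖ ≤ G)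
    {C : Fin n → Set (EuclideanSpace ℝ (Fin d))} (hC : ∀ j, IsClosed (C j))
    (hCc : ∀ j, Convex ℝ (C j)) (hFC : ∀ j, F ⊆ C j) {a c : ℝ} (ha : 0 ≤ a) (hc : 0 < c)
    (hm₁ : m₁ ≤ mΩ) {s : Fin (b + 1) → Ω → Fin n}
    (hs : ∀ r, Measurable (s r))
    (hind : ProbabilityTheory.Indep (MeasurableSpace.comap (s 0) inferInstance) m₁ P)
    {p : Fin n → ℝ} (hp : ∀ j, P.real {ω | s 0 ω = j} = p j)
    (hreg : ∀ x, Metric.infDist x F ^ 2 ≤ c * ∫ ω, Metric.infDist x (C (s 0 ω)) ^ 2 ∂P)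
    {w : Ω → ℝ} (hw : Measurable[m₁] w) (hw0 : ∀ ω, 0 ≤ w ω) (hw1 : ∀ ω, w ω ≤ 1)
    {v x' : Ω → EuclideanSpace ℝ (Fin d)} (hv : Measurable[m₁] v) (hx'm : Measurable x')
    (hx' : ∀ ω, x' ω = batchProj (b + 1) (fun r => C (s r ω)) (v ω - a • gradient f (v ω)))
    (hvi : Integrable (fun ω => w ω * Metric.infDist (v ω) F ^ 2) P) :
    Integrable (fun ω => w ω * Metric.infDist (x' ω) F ^ 2) P ∧
    ∫ ω, w ω * Metric.infDist (x' ω) F ^ 2 ∂P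
        + (4 * c)⁻¹ * ∫ ω, w ω * Metric.infDist (v ω) F ^ 2 ∂P
      ≤ (1 + ((1 + c⁻¹) * (2 * G ^ 2 + 2 * L ^ 2) + 4 * c * G ^ 2) * a ^ 2)
          * ∫ ω, w ω * Metric.infDist (v ω) F ^ 2 ∂P
        + ((1 + c⁻¹) * (2 * G ^ 2 + 2 * L ^ 2) + 4 * c * G ^ 2) * a ^ 2 := by
  set K := (1 + c⁻¹) * (2 * G ^ 2 + 2 * L ^ 2) + 4 * c * G ^ 2
  have hK0 : 0 ≤ K := by positivity
  set ψ : Ω → EuclideanSpace ℝ (Fin d) := fun ω => v ω - a • gradient f (v ω) with hψ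
  have hψm : Measurable[m₁] ψ := hv.sub ((hgc.measurable.comp hv).const_smul a)
  have hdist : ∀ s : Set (EuclideanSpace ℝ (Fin d)), ∀ u : Ω → EuclideanSpace ℝ (Fin d),
      ∀ m₂ : MeasurableSpace Ω, Measurable[m₂] u →
      Measurable[m₂] fun ω => Metric.infDist (u ω) s ^ 2 := fun s u m₂ hu =>
    ((Metric.continuous_infDist_pt s).measurable.comp hu).pow_const 2
  have hwm : Measurable w := hw.mono hm₁ le_rfl
  have hwi : Integrable w P := Integrable.of_bound hwm.aestronglyMeasurable 1
    (Eventually.of_forall fun ω => by rw [Real.norm_of_nonneg (hw0 ω)]; exact hw1 ω)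
  have hψF : Integrable (fun ω => w ω * Metric.infDist (ψ ω) F ^ 2) P := by
    refine Integrable.mono' (((hvi.const_mul (2 + 4 * L ^ 2 * a ^ 2))).add
      (hwi.const_mul (4 * G ^ 2 * a ^ 2)))
      (hwm.mul ((hdist F ψ m₁ hψm).mono hm₁ le_rfl)).aestronglyMeasurable
      (Eventually.of_forall fun ω => ?_)
    rw [Real.norm_of_nonneg (mul_nonneg (hw0 ω) (sq_nonneg _))]
    have h1 := (infDist_gradient_step_sq_le (F := F) ha (v ω) (gradient f (v ω))).1
    have h2 := sq_mul_norm_gradient_sq_le hF hne hG hL (le_refl (a ^ 2)) (v ω)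
    have h3 : Metric.infDist (ψ ω) F ^ 2 ≤ (2 + 4 * L ^ 2 * a ^ 2) * Metric.infDist (v ω) F ^ 2
        + 4 * G ^ 2 * a ^ 2 := by
      simp only [hψ]
      linarith
    have h4 := mul_le_mul_of_nonneg_left h3 (hw0 ω)
    simp only [Pi.add_apply]
    linarith
  obtain ⟨hψS, hkey⟩ := integral_infDist_sampled_ge hne hFC hc hm₁ (hs 0) hind hp hreg hw hw0 hψm
    hψF
  have hpath : ∀ ω, w ω * Metric.infDist (x' ω) F ^ 2
      + w ω * Metric.infDist (ψ ω) (C (s 0 ω)) ^ 2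
      + (4 * c)⁻¹ * (w ω * Metric.infDist (v ω) F ^ 2)
      ≤ (1 + K * a ^ 2) * (w ω * Metric.infDist (v ω) F ^ 2) + K * a ^ 2 * w ω
        + c⁻¹ * (w ω * Metric.infDist (ψ ω) F ^ 2) := by
    intro ω
    have := mul_le_mul_of_nonneg_left (infDist_batchProj_step_le hF hne hf hd hL hG hC hCc hFC ha
      hc (fun r => s r ω) (v ω)) (hw0 ω)
    rw [← hx'] at this
    linarith
  have hrhs : Integrable (fun ω => (1 + K * a ^ 2) * (w ω * Metric.infDist (v ω) F ^ 2)
      + K * a ^ 2 * w ω + c⁻¹ * (w ω * Metric.infDist (ψ ω) F ^ 2)) P :=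
    ((hvi.const_mul _).add (hwi.const_mul _)).add (hψF.const_mul _)
  have hx'i : Integrable (fun ω => w ω * Metric.infDist (x' ω) F ^ 2) P := by
    refine Integrable.mono' hrhs (hwm.mul (hdist F x' mΩ hx'm)).aestronglyMeasurable
      (Eventually.of_forall fun ω => ?_)
    have h1 := mul_nonneg (hw0 ω) (sq_nonneg (Metric.infDist (ψ ω) (C (s 0 ω))))
    have h2 : 0 ≤ (4 * c)⁻¹ * (w ω * Metric.infDist (v ω) F ^ 2) :=
      mul_nonneg (by positivity) (mul_nonneg (hw0 ω) (sq_nonneg _))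
    rw [Real.norm_of_nonneg (mul_nonneg (hw0 ω) (sq_nonneg _))]
    linarith [hpath ω]
  refine ⟨hx'i, ?_⟩
  have hint := integral_mono ((hx'i.add hψS).add (hvi.const_mul (4 * c)⁻¹)) hrhs hpath
  simp only [Pi.add_apply] at hint
  have hl : Integrable (fun ω => w ω * Metric.infDist (x' ω) F ^ 2
      + w ω * Metric.infDist (ψ ω) (C (s 0 ω)) ^ 2) P := hx'i.add hψS
  have hr : Integrable (fun ω => (1 + K * a ^ 2) * (w ω * Metric.infDist (v ω) F ^ 2)
      + K * a ^ 2 * w ω) P := (hvi.const_mul _).add (hwi.const_mul _)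
  rw [integral_add hl (hvi.const_mul _), integral_add hx'i hψS,
    integral_add hr (hψF.const_mul _),
    integral_add (hvi.const_mul _) (hwi.const_mul _), integral_const_mul, integral_const_mul,
    integral_const_mul, integral_const_mul] at hint
  have hw1' : ∫ ω, w ω ∂P ≤ 1 := by
    have := integral_mono hwi (integrable_const (1 : ℝ)) hw1
    simpa using this
  have := mul_le_mul_of_nonneg_left hw1' (mul_nonneg hK0 (sq_nonneg a))
  linarith

end Probability

/-! ### The past of the algorithm -/

section Past

variable {Ω : Type*} {d m b : ℕ} {n : Fin m → ℕ} {x₀ : Fin m → Ω → EuclideanSpace ℝ (Fin d)}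
  {S : (i : Fin m) → ℕ → Fin b → Ω → Fin (n i)}

theorem past_le [mΩ : MeasurableSpace Ω] (hx₀ : ∀ i, Measurable (x₀ i))
    (hS : ∀ i k r, Measurable (S i k r)) (k : ℕ) : past x₀ S k ≤ mΩ :=
  sup_le (iSup_le fun i => (hx₀ i).comap_le)
    (iSup_le fun i => iSup_le fun t => iSup_le fun _ => iSup_le fun r => (hS i t r).comap_le)

theorem measurable_past_initial (k : ℕ) (i : Fin m) : Measurable[past x₀ S k] (x₀ i) :=
  measurable_iff_comap_le.2 (le_sup_of_le_left (le_iSup_of_le i le_rfl))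

theorem measurable_past_sample {k t : ℕ} (h : t < k) (i : Fin m) (r : Fin b) :
    Measurable[past x₀ S k] (S i t r) :=
  measurable_iff_comap_le.2 (le_sup_of_le_right (le_iSup_of_le i (le_iSup_of_le t
    (le_iSup_of_le h (le_iSup_of_le r le_rfl)))))

theorem past_mono {k l : ℕ} (h : k ≤ l) : past x₀ S k ≤ past x₀ S l :=
  sup_le (iSup_le fun i => (measurable_past_initial l i).comap_le)
    (iSup_le fun i => iSup_le fun _ => iSup_le fun ht => iSup_le fun r =>
      (measurable_past_sample (lt_of_lt_of_le ht h) i r).comap_le)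

/-- The iterates at time `k` are functions of the initial points and of the earlier samples. -/
theorem measurable_past_iterates {f : Fin m → EuclideanSpace ℝ (Fin d) → ℝ}
    (hg : ∀ i, Continuous (gradient (f i)))
    {X : (i : Fin m) → Fin (n i) → Set (EuclideanSpace ℝ (Fin d))}
    (hX : ∀ i j, IsClosed (X i j)) (hXc : ∀ i j, Convex ℝ (X i j))
    (hne : ∀ i j, (X i j).Nonempty) (W : ℕ → Matrix (Fin m) (Fin m) ℝ) (α : ℕ → ℝ) (k : ℕ)
    (i : Fin m) :
    Measurable[past x₀ S k] fun ω =>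
      iterates f X W α (fun l => x₀ l ω) (fun l t r => S l t r ω) k i := by
  induction k generalizing i with
  | zero => exact measurable_past_initial 0 i
  | succ k ih =>
    have hx : ∀ j, Measurable[past x₀ S (k + 1)] fun ω =>
        iterates f X W α (fun l => x₀ l ω) (fun l t r => S l t r ω) k j := fun j =>
      (ih j).mono (past_mono (Nat.le_succ k)) le_rfl
    have hv : Measurable[past x₀ S (k + 1)] fun ω =>
        mix (W k) (iterates f X W α (fun l => x₀ l ω) (fun l t r => S l t r ω) k) i := by
      let _ := past x₀ S (k + 1)
      exact Finset.measurable_fun_sum _ fun j _ => (hx j).const_smul (W k i j)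
    let _ := past x₀ S (k + 1)
    have h1 : Measurable fun q : (Fin b → Fin (n i)) × EuclideanSpace ℝ (Fin d) =>
        batchProj b (fun r => X i (q.1 r)) q.2 :=
      measurable_from_prod_countable_right fun s =>
        (continuous_batchProj (fun r => hX i (s r)) (fun r => hXc i (s r))
          (fun r => hne i (s r))).measurable
    have h2 : Measurable fun ω => fun r => S i k r ω :=
      measurable_pi_iff.2 fun r => measurable_past_sample (Nat.lt_succ_self k) i r
    exact h1.comp (h2.prodMk (hv.sub (((hg i).measurable.comp hv).const_smul (α k))))

end Past

/-! ### The feasible set and the optimal set -/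

section Feasible

variable {d m : ℕ} {n : Fin m → ℕ} {X : (i : Fin m) → Fin (n i) → Set (EuclideanSpace ℝ (Fin d))}

theorem feasibleSet_subset (i : Fin m) (j : Fin (n i)) : feasibleSet X ⊆ X i j :=
  fun _ hx => Set.mem_iInter.1 (Set.mem_iInter.1 hx i) j

theorem isClosed_feasibleSet (hX : ∀ i j, IsClosed (X i j)) : IsClosed (feasibleSet X) :=
  isClosed_iInter fun i => isClosed_iInter fun j => hX i j

theorem convex_feasibleSet (hX : ∀ i j, Convex ℝ (X i j)) : Convex ℝ (feasibleSet X) :=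
  convex_iInter fun i => convex_iInter fun j => hX i j

theorem isClosed_optimalSet {f : Fin m → EuclideanSpace ℝ (Fin d) → ℝ}
    (hf : ∀ i, Continuous (f i)) (hX : ∀ i j, IsClosed (X i j)) : IsClosed (optimalSet f X) := by
  have hφ : Continuous fun y => ∑ i, f i y := continuous_finsetSum _ fun i _ => hf i
  have e : optimalSet f X
      = feasibleSet X ∩ ⋂ y ∈ feasibleSet X, {x | ∑ i, f i x ≤ ∑ i, f i y} := by
    ext x
    simp [optimalSet, isMinOn_iff]
  rw [e]
  exact (isClosed_feasibleSet hX).inter (isClosed_biInter fun y _ =>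
    isClosed_le hφ continuous_const)

end Feasible

/-! ### Almost sure summability of the distances to the feasible set -/

section Stochastic

variable {Ω : Type*} [mΩ : MeasurableSpace Ω] {P : Measure Ω} [IsProbabilityMeasure P]
  {d m b : ℕ} {n : Fin m → ℕ}

/-- The stochastic half of the argument: almost surely the squared distances of the mixed points to
the feasible set are summable. -/
theorem ae_summable_infDist_mix_sq {f : Fin m → EuclideanSpace ℝ (Fin d) → ℝ}
    {X : (i : Fin m) → Fin (n i) → Set (EuclideanSpace ℝ (Fin d))}
    (hX : ∀ i j, IsClosed (X i j)) (hXc : ∀ i j, Convex ℝ (X i j))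
    (hne : (feasibleSet X).Nonempty)
    (hf : ∀ i, ConvexOn ℝ Set.univ (f i)) (hd : ∀ i, Differentiable ℝ (f i))
    {G L : ℝ} (hgc : ∀ i, Continuous (gradient (f i)))
    (hL : ∀ i x y, ‖gradient (f i) x - gradient (f i) y‖ ≤ L * ‖x - y‖)
    (hG : ∀ i, ∀ x ∈ feasibleSet X, ‖gradient (f i) x‖ ≤ G)
    {W : ℕ → Matrix (Fin m) (Fin m) ℝ} (hW : ∀ k i j, 0 ≤ W k i j)
    (hrow : ∀ k i, ∑ j, W k i j = 1) (hcol : ∀ k j, ∑ i, W k i j = 1)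
    {α : ℕ → ℝ} (hα : ∀ k, 0 < α k) (hα_sq : Summable fun k => α k ^ 2)
    {x₀ : Fin m → Ω → EuclideanSpace ℝ (Fin d)} (hx₀ : ∀ i, Measurable (x₀ i))
    {S : (i : Fin m) → ℕ → Fin (b + 1) → Ω → Fin (n i)} (hS : ∀ i k r, Measurable (S i k r))
    {p : (i : Fin m) → Fin (n i) → ℝ} (hp : ∀ i k r j, P.real {ω | S i k r ω = j} = p i j)
    (hpast : ∀ i k, ProbabilityTheory.Indep
      (⨆ r, MeasurableSpace.comap (S i k r) inferInstance) (past x₀ S k) P)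
    (hreg : ∀ i, ∃ c : ℝ, 0 < c ∧ ∀ k r x, Metric.infDist x (feasibleSet X) ^ 2 ≤
        c * ∫ ω, Metric.infDist x (X i (S i k r ω)) ^ 2 ∂P) :
    ∀ᵐ ω ∂P, ∀ i, Summable fun k => Metric.infDist
      (mix (W k) (iterates f X W α (fun l => x₀ l ω) (fun l t r => S l t r ω) k) i)
      (feasibleSet X) ^ 2 := by
  set F := feasibleSet X
  have hF : IsClosed F := isClosed_feasibleSet hX
  have hFc : Convex ℝ F := convex_feasibleSet hXc
  set x : ℕ → Fin m → Ω → EuclideanSpace ℝ (Fin d) := fun k i ω =>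
    iterates f X W α (fun l => x₀ l ω) (fun l t r => S l t r ω) k i
  set v : ℕ → Fin m → Ω → EuclideanSpace ℝ (Fin d) := fun k i ω =>
    mix (W k) (fun j => x k j ω) i
  have hxm : ∀ k i, Measurable[past x₀ S k] (x k i) := fun k i =>
    measurable_past_iterates hgc hX hXc (fun i j => hne.mono (feasibleSet_subset i j)) W α k i
  have hvm : ∀ k i, Measurable[past x₀ S k] (v k i) := fun k i =>
    Finset.measurable_fun_sum _ fun j _ => (hxm k j).const_smul (W k i j)
  have hle : ∀ k, past x₀ S k ≤ mΩ := past_le hx₀ hS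
  have hdm : ∀ {m₂ : MeasurableSpace Ω} {u : Ω → EuclideanSpace ℝ (Fin d)}, Measurable[m₂] u →
      Measurable[m₂] fun ω => Metric.infDist (u ω) F ^ 2 := fun hu =>
    ((Metric.continuous_infDist_pt F).measurable.comp hu).pow_const 2
  -- one constant for all agents
  choose c₀ hc₀ hreg₀ using hreg
  set c := 1 + ∑ i, c₀ i
  have hc : 0 < c := add_pos_of_pos_of_nonneg one_pos (Finset.sum_nonneg fun i _ => (hc₀ i).le)
  have hcle : ∀ i, c₀ i ≤ c := fun i => by
    have := Finset.single_le_sum (f := c₀) (fun i _ => (hc₀ i).le) (Finset.mem_univ i)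
    linarith
  have hregc : ∀ i k y, Metric.infDist y F ^ 2
      ≤ c * ∫ ω, Metric.infDist y (X i (S i k 0 ω)) ^ 2 ∂P := fun i k y =>
    (hreg₀ i k 0 y).trans (mul_le_mul_of_nonneg_right (hcle i)
      (integral_nonneg fun _ => sq_nonneg _))
  -- the initial points need not be integrable; this weight makes up for it
  set w : Ω → ℝ := fun ω => (1 + ∑ i, Metric.infDist (x₀ i ω) F ^ 2)⁻¹ with hw
  have hpos : ∀ ω, 0 ≤ ∑ i, Metric.infDist (x₀ i ω) F ^ 2 := fun ω =>
    Finset.sum_nonneg fun i _ => sq_nonneg _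
  have hwpos : ∀ ω, 0 < w ω := fun ω => inv_pos.2 (by linarith [hpos ω])
  have hw1 : ∀ ω, w ω ≤ 1 := fun ω => inv_le_one_of_one_le₀ (by linarith [hpos ω])
  have hwm : ∀ k, Measurable[past x₀ S k] w := fun k =>
    (measurable_const.add (Finset.measurable_fun_sum _ fun i _ =>
      hdm (measurable_past_initial k i))).inv
  have hwm' : Measurable w := (hwm 0).mono (hle 0) le_rfl
  have hvi_of : ∀ k, (∀ i, Integrable (fun ω => w ω * Metric.infDist (x k i ω) F ^ 2) P) →
      ∀ i, Integrable (fun ω => w ω * Metric.infDist (v k i ω) F ^ 2) P := by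
    intro k hk i
    refine Integrable.mono' (integrable_finsetSum Finset.univ fun j _ =>
      (hk j).const_mul (W k i j)) (hwm'.mul ((hdm (hvm k i)).mono (hle k)
        le_rfl)).aestronglyMeasurable (Eventually.of_forall fun ω => ?_)
    rw [Real.norm_of_nonneg (mul_nonneg (hwpos ω).le (sq_nonneg _))]
    refine (mul_le_mul_of_nonneg_left (infDist_mix_sq_le hF hFc hne (hW k) (hrow k)
      (fun j => x k j ω) i) (hwpos ω).le).trans_eq ?_
    rw [Finset.mul_sum]
    exact Finset.sum_congr rfl fun j _ => by ring
  set K := (1 + c⁻¹) * (2 * G ^ 2 + 2 * L ^ 2) + 4 * c * G ^ 2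
  have hK0 : 0 ≤ K := by positivity
  have hstep : ∀ k i, Integrable (fun ω => w ω * Metric.infDist (v k i ω) F ^ 2) P →
      Integrable (fun ω => w ω * Metric.infDist (x (k + 1) i ω) F ^ 2) P ∧
      ∫ ω, w ω * Metric.infDist (x (k + 1) i ω) F ^ 2 ∂P
        + (4 * c)⁻¹ * ∫ ω, w ω * Metric.infDist (v k i ω) F ^ 2 ∂P
      ≤ (1 + K * α k ^ 2) * ∫ ω, w ω * Metric.infDist (v k i ω) F ^ 2 ∂P + K * α k ^ 2 :=
    fun k i hvi => integral_infDist_step_le hF hne (hf i) (hd i) (hgc i) (hL i) (hG i) (hX i)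
      (hXc i) (feasibleSet_subset i) (hα k).le hc (hle k) (hS i k)
      (ProbabilityTheory.indep_of_indep_of_le_left (hpast i k)
        (le_iSup (fun r => MeasurableSpace.comap (S i k r) inferInstance) 0))
      (hp i k 0) (hregc i k) (hwm k) (fun ω => (hwpos ω).le) hw1 (hvm k i)
      ((hxm (k + 1) i).mono (hle _) le_rfl) (fun ω => rfl) hvi
  have hxi : ∀ k i, Integrable (fun ω => w ω * Metric.infDist (x k i ω) F ^ 2) P := by
    intro k
    induction k with
    | zero =>
      intro i
      refine Integrable.of_bound (hwm'.mul ((hdm (hxm 0 i)).mono (hle 0)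
        le_rfl)).aestronglyMeasurable 1 (Eventually.of_forall fun ω => ?_)
      rw [Real.norm_of_nonneg (mul_nonneg (hwpos ω).le (sq_nonneg _))]
      have h1 : Metric.infDist (x 0 i ω) F ^ 2 ≤ ∑ i, Metric.infDist (x₀ i ω) F ^ 2 :=
        Finset.single_le_sum (f := fun i => Metric.infDist (x₀ i ω) F ^ 2)
          (fun _ _ => sq_nonneg _) (Finset.mem_univ i)
      rw [hw, inv_mul_le_iff₀ (by linarith [hpos ω])]
      linarith
    | succ k ih => exact fun i => (hstep k i (hvi_of k ih i)).1
  have hvi : ∀ k i, Integrable (fun ω => w ω * Metric.infDist (v k i ω) F ^ 2) P := fun k =>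
    hvi_of k (hxi k)
  have hvx : ∀ k, ∑ i, ∫ ω, w ω * Metric.infDist (v k i ω) F ^ 2 ∂P
      ≤ ∑ i, ∫ ω, w ω * Metric.infDist (x k i ω) F ^ 2 ∂P := by
    intro k
    rw [← integral_finsetSum _ fun i _ => hvi k i, ← integral_finsetSum _ fun i _ => hxi k i]
    refine integral_mono (integrable_finsetSum _ fun i _ => hvi k i)
      (integrable_finsetSum _ fun i _ => hxi k i) fun ω => ?_
    simp only [← Finset.mul_sum]
    refine mul_le_mul_of_nonneg_left ((Finset.sum_le_sum fun i _ =>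
      infDist_mix_sq_le hF hFc hne (hW k) (hrow k) (fun j => x k j ω) i).trans_eq ?_) (hwpos ω).le
    rw [Finset.sum_comm]
    exact Finset.sum_congr rfl fun j _ => by rw [← Finset.sum_mul, hcol, one_mul]
  have hv0 : ∀ k i, 0 ≤ ∫ ω, w ω * Metric.infDist (v k i ω) F ^ 2 ∂P := fun k i =>
    integral_nonneg fun ω => mul_nonneg (hwpos ω).le (sq_nonneg _)
  have hsum : Summable fun k => (4 * c)⁻¹ * ∑ i, ∫ ω, w ω * Metric.infDist (v k i ω) F ^ 2 ∂P := by
    refine summable_of_add_le_one_add_mul_add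
      (u := fun k => ∑ i, ∫ ω, w ω * Metric.infDist (x k i ω) F ^ 2 ∂P)
      (a := fun k => K * α k ^ 2) (β := fun k => m * (K * α k ^ 2))
      (fun k => Finset.sum_nonneg fun i _ => integral_nonneg fun ω =>
        mul_nonneg (hwpos ω).le (sq_nonneg _))
      (fun k => mul_nonneg (by positivity) (Finset.sum_nonneg fun i _ => hv0 k i))
      (fun k => by positivity) (fun k => by positivity) (hα_sq.mul_left K)
      ((hα_sq.mul_left K).mul_left _) fun k => ?_
    have h1 := Finset.sum_le_sum fun i (_ : i ∈ Finset.univ) => (hstep k i (hvi k i)).2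
    rw [Finset.sum_add_distrib, Finset.sum_add_distrib, ← Finset.mul_sum, ← Finset.mul_sum,
      Finset.sum_const, Finset.card_univ, Fintype.card_fin, nsmul_eq_mul] at h1
    exact h1.trans (add_le_add_left (mul_le_mul_of_nonneg_left (hvx k) (by positivity)) _)
  refine ae_all_iff.2 fun i => ?_
  have hsum' := (summable_mul_left_iff (by positivity : (4 * c)⁻¹ ≠ 0)).1 hsum
  have hi : Summable fun k => ∫ ω, w ω * Metric.infDist (v k i ω) F ^ 2 ∂P :=
    Summable.of_nonneg_of_le (fun k => hv0 k i) (fun k => Finset.single_le_sum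
      (f := fun i => ∫ ω, w ω * Metric.infDist (v k i ω) F ^ 2 ∂P) (fun i _ => hv0 k i)
      (Finset.mem_univ i)) hsum'
  filter_upwards [ae_summable_of_summable_integral
    (fun k ω => mul_nonneg (hwpos ω).le (sq_nonneg _)) (fun k => hvi k i) hi] with ω hω
  exact (summable_mul_left_iff (hwpos ω).ne').1 hω

end Stochastic

end DRP

theorem proposition2 {d m b : ℕ} (hb : 1 ≤ b) {n : Fin m → ℕ}
    -- the optimization problem
    (f : Fin m → EuclideanSpace ℝ (Fin d) → ℝ)
    (X : (i : Fin m) → Fin (n i) → Set (EuclideanSpace ℝ (Fin d)))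
    (hX_closed : ∀ i j, IsClosed (X i j))
    (hX_convex : ∀ i j, Convex ℝ (X i j))
    (hf_convex : ∀ i, ConvexOn ℝ Set.univ (f i))
    (hf_diff : ∀ i, Differentiable ℝ (f i))
    (hf_lip : ∃ L : ℝ, ∀ i x y, ‖gradient (f i) x - gradient (f i) y‖ ≤ L * ‖x - y‖)
    (hf_bdd : ∃ G : ℝ, ∀ i, ∀ x ∈ DRP.feasibleSet X, ‖gradient (f i) x‖ ≤ G)
    (hopt : (DRP.optimalSet f X).Nonempty)
    -- the network: `(E k).Adj i j` means that agent `i` receives information from `j` at time `k`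
    (E : ℕ → Digraph (Fin m))
    (hE_self : ∀ k i, (E k).Adj i i)
    (hE_conn : ∃ Q : ℕ, ∀ k, DRP.StronglyConnected (⨆ l ∈ Finset.range Q, E (k + l)))
    -- the weights
    (W : ℕ → Matrix (Fin m) (Fin m) ℝ)
    (hW_nonneg : ∀ k i j, 0 ≤ W k i j)
    (hW_zero : ∀ k i j, ¬ (E k).Adj i j → W k i j = 0)
    (hW_row : ∀ k i, ∑ j, W k i j = 1)
    (hW_lower : ∃ η ∈ Set.Ioo (0 : ℝ) 1, ∀ k i j, (E k).Adj i j → η ≤ W k i j)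
    (hW_col : ∀ k j, ∑ i, W k i j = 1)
    -- the stepsizes
    (α : ℕ → ℝ)
    (hα_pos : ∀ k, 0 < α k)
    (hα_sum : Filter.Tendsto (fun N => ∑ k ∈ Finset.range N, α k) Filter.atTop Filter.atTop)
    (hα_sq : Summable fun k => α k ^ 2)
    -- the random initial points and the random samples
    {Ω : Type*} [MeasurableSpace Ω] (P : MeasureTheory.Measure Ω)
    [MeasureTheory.IsProbabilityMeasure P]
    (x₀ : Fin m → Ω → EuclideanSpace ℝ (Fin d))
    (hx₀ : ∀ i, Measurable (x₀ i))
    (S : (i : Fin m) → ℕ → Fin b → Ω → Fin (n i))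
    (hS_meas : ∀ i k r, Measurable (S i k r))
    (p : (i : Fin m) → Fin (n i) → ℝ)
    (hp_pos : ∀ i j, 0 < p i j)
    (hS_law : ∀ i k r j, P.real {ω | S i k r ω = j} = p i j)
    (hS_batch : ∀ i k, ProbabilityTheory.iIndepFun (fun r => S i k r) P)
    (hS_past : ∀ i k, ProbabilityTheory.Indep
      (⨆ r, MeasurableSpace.comap (S i k r) inferInstance) (DRP.past x₀ S k) P)
    -- set regularity: the expected squared distance to a sampled component controls the squared
    -- distance to the feasible set
    (hreg : ∀ i, ∃ c : ℝ, 0 < c ∧ ∀ k r x,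
      Metric.infDist x (DRP.feasibleSet X) ^ 2 ≤
        c * ∫ ω, Metric.infDist x (X i (S i k r ω)) ^ 2 ∂P) :
    ∃ xstar : Ω → EuclideanSpace ℝ (Fin d), Measurable xstar ∧
      (∀ ω, xstar ω ∈ DRP.optimalSet f X) ∧
      ∀ᵐ ω ∂P, ∀ i, Filter.Tendsto
        (fun k => DRP.iterates f X W α (fun l => x₀ l ω) (fun l t r => S l t r ω) k i)
        Filter.atTop (nhds (xstar ω)) := by

  classical
  -- the batch has a first projection
  obtain ⟨b, rfl⟩ : ∃ b', b = b' + 1 := ⟨b - 1, by omega⟩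
  obtain ⟨L₀, hL₀⟩ := hf_lip
  obtain ⟨G₀, hG₀⟩ := hf_bdd
  obtain ⟨Q, hQ⟩ := hE_conn
  obtain ⟨η, hη, hWη⟩ := hW_lower
  obtain ⟨y₀, hy₀⟩ := hopt
  have hG : ∀ i, ∀ x ∈ DRP.feasibleSet X, ‖gradient (f i) x‖ ≤ |G₀| := fun i x hx =>
    (hG₀ i x hx).trans (le_abs_self _)
  have hgc : ∀ i, Continuous (gradient (f i)) := fun i =>
    (LipschitzWith.of_dist_le_mul (K := ⟨|L₀|, abs_nonneg _⟩) fun x y => by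
      rw [dist_eq_norm, dist_eq_norm]
      exact (hL₀ i x y).trans
        (mul_le_mul_of_nonneg_right (le_abs_self _) (norm_nonneg _))).continuous
  have hF := DRP.isClosed_feasibleSet hX_closed
  have hae := DRP.ae_summable_infDist_mix_sq (P := P) hX_closed hX_convex ⟨y₀, hy₀.1⟩ hf_convex
    hf_diff hgc hL₀ hG hW_nonneg hW_row hW_col hα_pos hα_sq hx₀ hS_meas hS_law hS_past hreg
  have hlim : ∀ᵐ ω ∂P, ∃ y ∈ DRP.optimalSet f X, ∀ i, Filter.Tendsto
      (fun k => DRP.iterates f X W α (fun l => x₀ l ω) (fun l t r => S l t r ω) k i)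
      Filter.atTop (nhds y) := by
    filter_upwards [hae] with ω hω
    obtain ⟨y, hy, hmin, hlim⟩ := DRP.exists_forall_tendsto_of_summable_infDist_sq hF hf_convex
      hf_diff (abs_nonneg G₀) hL₀ hG ⟨y₀, hy₀⟩ hW_nonneg hW_row hW_col hη.1 hE_self hWη hQ hα_pos
      hα_sum hα_sq
      (x := DRP.iterates f X W α (fun l => x₀ l ω) (fun l t r => S l t r ω))
      (fun k i y hy => DRP.norm_batchProj_sub_le (fun r => hX_closed i _) (fun r => hX_convex i _)
        _ fun r => DRP.feasibleSet_subset i _ hy) hω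
    exact ⟨y, ⟨hy, hmin⟩, hlim⟩
  rcases Nat.eq_zero_or_pos m with rfl | hm
  · exact ⟨fun _ => y₀, measurable_const, fun _ => hy₀,
      Filter.Eventually.of_forall fun ω i => i.elim0⟩
  -- the limit of the iterates of one agent, replaced by `y₀` where it fails to be optimal
  obtain ⟨l, hl, hlω⟩ := measurable_limit_of_tendsto_metrizable_ae (μ := P)
    (fun k => (((DRP.measurable_past_iterates hgc hX_closed hX_convex
      (fun i j => ⟨y₀, DRP.feasibleSet_subset i j hy₀.1⟩) W α k ⟨0, hm⟩).mono
      (DRP.past_le hx₀ hS_meas k) le_rfl).aemeasurable))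
    (hlim.mono fun ω ⟨y, _, hy⟩ => ⟨y, hy ⟨0, hm⟩⟩)
  have hset : MeasurableSet {ω | l ω ∈ DRP.optimalSet f X} :=
    hl (DRP.isClosed_optimalSet (fun i => (hf_diff i).continuous) hX_closed).measurableSet
  refine ⟨fun ω => if l ω ∈ DRP.optimalSet f X then l ω else y₀,
    Measurable.ite hset hl measurable_const, fun ω => ?_, ?_⟩
  · dsimp only
    split_ifs with h
    · exact h
    · exact hy₀
  · filter_upwards [hlim, hlω] with ω ⟨y, hy, hω⟩ hlω i
    have e : l ω = y := tendsto_nhds_unique hlω (hω ⟨0, hm⟩)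
    simpa [e, hy] using hω i
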